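/- Let $n\ge 1$. Let $\Gamma\subset\mathbb R^n$ be an open convex cone, invariant under permutations of the coordinates, that contains $(\lambda,\dots,\lambda)$ for all $\lambda>0$, and let $F:\Gamma\to\mathbb R$ be a smooth symmetric function with $F>0$ and $\partial F/\partial\lambda_i>0$ on $\Gamma$ for all $i$. Let $M$ be a closed $n$-dimensional smooth manifold, let $-\infty\le T_0<T_1\le+\infty$, and let $\varphi:M\times(T_0,T_1)\to\mathbb R^{n+1}$ be a smooth map such that each $\varphi(\cdot,t)$ is a smooth embedding whose image $M_t=\varphi(M,t)$ is the boundary of a bounded open connected set $\Omega_t$ (such a set exists automatically if $M$ is connected). Assume that for all $t$ the principal curvatures $\lambda_1,\dots,\lambda_n$ of $M_t$ with respect to the unit normal $\nu$ pointing out of $\Omega_t$ (with the sign for which round spheres have positive principal curvatures) satisfy $(\lambda_1,\dots,\lambda_n)\in\Gamma$, and that $$\frac{\partial\varphi}{\partial t}=\frac{\nu}{F(\lambda_1,\dots,\lambda_n)}\quad\text{on } M\times(T_0,T_1).$$ (1) If $M_t$ comes out of a point $y\in\mathbb R^{n+1}$, i.e. for every $r>0$ there is $t\in(T_0,T_1)$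 such that $M_t$ is contained in the open ball $B_r(y)$, then $M_t$ is a family of homothetically expanding spheres: there is a strictly increasing function $\rho:(T_0,T_1)\to(0,\infty)$ such that $M_t=\{x:|x-y|=\rho(t)\}$ for all $t\in(T_0,T_1)$. (2) In particular, spheres are the only compact homothetically expanding solitons: if there are $y\in\mathbb R^{n+1}$, a set $S\subset\mathbb R^{n+1}$ and a strictly increasing function $c:(T_0,T_1)\to(0,\infty)$ with $\inf c=0$ such that $M_t=\{y+c(t)(x-y):x\in S\}$ for all $t\in(T_0,T_1)$, then $S$ is a sphere centred at $y$, and $M_t$ is a family of spheres centred at $y$ with strictly increasing radii. -/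

import Mathlib

open scoped Manifold ContDiff Topology
open Set Filter

/-- The time interval `(T₀, T₁)`, where `-∞ ≤ T₀` and `T₁ ≤ +∞`. -/
def timeInterval (T₀ T₁ : EReal) : Set ℝ :=
  {t : ℝ | T₀ < (t : EReal) ∧ (t : EReal) < T₁}

/-- `F` is an admissible speed on `Γ`: `Γ ⊆ ℝⁿ` is an open convex symmetric cone containing the
positive diagonal, and `F` is a smooth positive symmetric function on `Γ` all of whose first
partial derivatives are positive. (The values of `F` outside `Γ` are irrelevant.) -/
structure IsAdmissibleSpeed {n : ℕ} (Γ : Set (Fin n → ℝ)) (F : (Fin n → ℝ) → ℝ) : Prop where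
  isOpen : IsOpen Γ
  convex : Convex ℝ Γ
  cone : ∀ c : ℝ, 0 < c → ∀ x ∈ Γ, c • x ∈ Γ
  symm_cone : ∀ σ : Equiv.Perm (Fin n), ∀ x ∈ Γ, x ∘ σ ∈ Γ
  diagonal : ∀ c : ℝ, 0 < c → (fun _ : Fin n => c) ∈ Γ
  smooth : ContDiffOn ℝ ∞ F Γ
  symm : ∀ σ : Equiv.Perm (Fin n), ∀ x ∈ Γ, F (x ∘ σ) = F x
  pos : ∀ x ∈ Γ, 0 < F x
  partial_pos : ∀ x ∈ Γ, ∀ i : Fin n, 0 < fderiv ℝ F x (Pi.single i 1)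

/-- `Ω` is a bounded open domain whose boundary is the set `S`. -/
structure IsEnclosedDomain {n : ℕ} (Ω S : Set (EuclideanSpace ℝ (Fin (n + 1)))) : Prop where
  isOpen : IsOpen Ω
  isConnected : IsConnected Ω
  isBounded : Bornology.IsBounded Ω
  frontier_eq : frontier Ω = S

section Hypersurface

variable {n : ℕ} {M : Type*} [TopologicalSpace M] [ChartedSpace (EuclideanSpace ℝ (Fin n)) M]

/-- The differential at `p` of a map `f : M → ℝⁿ⁺¹`, with values in `ℝⁿ⁺¹`. -/
noncomputable def ambientDifferential (f : M → EuclideanSpace ℝ (Fin (n + 1))) (p : M) :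
    TangentSpace (𝓡 n) p →L[ℝ] EuclideanSpace ℝ (Fin (n + 1)) :=
  mfderiv (𝓡 n) (𝓡 (n + 1)) f p

/-- `N : M → ℝⁿ⁺¹` is the outer unit normal along the hypersurface `f`: it is a unit normal
field which points out of the bounded domain enclosed by `f(M)`. Both this domain and `N` are
uniquely determined by `f`. -/
def IsOuterUnitNormal (f N : M → EuclideanSpace ℝ (Fin (n + 1))) : Prop :=
  (∀ p : M, ‖N p‖ = 1) ∧
  (∀ (p : M) (v : TangentSpace (𝓡 n) p), inner ℝ (N p) (ambientDifferential f p v) = 0) ∧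
  ∃ Ω : Set (EuclideanSpace ℝ (Fin (n + 1))), IsEnclosedDomain Ω (range f) ∧
    ∀ p : M, ∀ᶠ s in 𝓝[>] (0 : ℝ), f p - s • N p ∈ Ω ∧ f p + s • N p ∉ closure Ω

/-- `κ` lists the principal curvatures (with multiplicity) at `p` of the hypersurface `f` with
unit normal field `N`: there is a basis `e` of `T_pM`, orthonormal for the induced metric, with
`dN(eᵢ) = κᵢ df(eᵢ)`. The sign is such that a sphere of radius `r` with its outer normal has all
principal curvatures equal to `1 / r`. -/
def IsPrincipalCurvatures (f N : M → EuclideanSpace ℝ (Fin (n + 1))) (p : M)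
    (κ : Fin n → ℝ) : Prop :=
  MDifferentiableAt (𝓡 n) (𝓡 (n + 1)) N p ∧
  ∃ e : Fin n → TangentSpace (𝓡 n) p,
    Orthonormal ℝ (fun i : Fin n => ambientDifferential f p (e i)) ∧
    ∀ i : Fin n, ambientDifferential N p (e i) = κ i • ambientDifferential f p (e i)

/-- `φ` (with `φ t : M → ℝⁿ⁺¹` the embedding at time `t`) is a smooth embedded solution of
`∂φ/∂t = ν / F` on the time interval `(T₀, T₁)`, where `ν` is the outer unit normal and `F` is
evaluated at the principal curvatures, which are required to lie in `Γ`. -/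
structure IsExpandingFlow (Γ : Set (Fin n → ℝ)) (F : (Fin n → ℝ) → ℝ) (T₀ T₁ : EReal)
    (φ : ℝ → M → EuclideanSpace ℝ (Fin (n + 1))) : Prop where
  smooth : ContMDiffOn (𝓘(ℝ, ℝ).prod (𝓡 n)) (𝓡 (n + 1)) ∞
    (fun q : ℝ × M => φ q.1 q.2) (timeInterval T₀ T₁ ×ˢ univ)
  embedded : ∀ t ∈ timeInterval T₀ T₁, Manifold.IsSmoothEmbedding (𝓡 n) (𝓡 (n + 1)) ∞ (φ t)
  evolution : ∀ t ∈ timeInterval T₀ T₁,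
    ∃ ν : M → EuclideanSpace ℝ (Fin (n + 1)), IsOuterUnitNormal (φ t) ν ∧
      ∀ p : M, ∃ κ : Fin n → ℝ, IsPrincipalCurvatures (φ t) ν p κ ∧ κ ∈ Γ ∧
        HasDerivAt (fun s : ℝ => φ s p) ((F κ)⁻¹ • ν p) t

end Hypersurface

section Families

variable {n : ℕ} {M : Type*}

/-- The hypersurfaces `M_t = φ t (M)` come out of the point `y`: every ball around `y` contains
`M_t` for some `t ∈ (T₀, T₁)`. -/
def ComesOutOfPoint (T₀ T₁ : EReal) (φ : ℝ → M → EuclideanSpace ℝ (Fin (n + 1)))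
    (y : EuclideanSpace ℝ (Fin (n + 1))) : Prop :=
  ∀ r : ℝ, 0 < r → ∃ t ∈ timeInterval T₀ T₁, range (φ t) ⊆ Metric.ball y r

/-- The hypersurfaces `M_t = φ t (M)`, `t ∈ (T₀, T₁)`, are concentric round spheres with centre
`y` whose radius is strictly increasing in time. -/
def IsExpandingSpheres (T₀ T₁ : EReal) (φ : ℝ → M → EuclideanSpace ℝ (Fin (n + 1)))
    (y : EuclideanSpace ℝ (Fin (n + 1))) : Prop :=
  ∃ ρ : ℝ → ℝ, StrictMonoOn ρ (timeInterval T₀ T₁) ∧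
    ∀ t ∈ timeInterval T₀ T₁, 0 < ρ t ∧ range (φ t) = Metric.sphere y (ρ t)

/-- The hypersurfaces `M_t = φ t (M)`, `t ∈ (T₀, T₁)`, expand homothetically from `y` with
profile `S`: each `M_t` is the image of `S` under the homothety with centre `y` and ratio `c t`,
where `c` is positive, strictly increasing, and tends to `0` as `t ↓ T₀`. -/
def IsHomotheticallyExpanding (T₀ T₁ : EReal) (φ : ℝ → M → EuclideanSpace ℝ (Fin (n + 1)))
    (y : EuclideanSpace ℝ (Fin (n + 1))) (S : Set (EuclideanSpace ℝ (Fin (n + 1)))) : Prop :=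
  ∃ c : ℝ → ℝ, StrictMonoOn c (timeInterval T₀ T₁) ∧
    (∀ t ∈ timeInterval T₀ T₁, 0 < c t) ∧
    (∀ ε : ℝ, 0 < ε → ∃ t ∈ timeInterval T₀ T₁, c t < ε) ∧
    ∀ t ∈ timeInterval T₀ T₁, range (φ t) = AffineMap.homothety y (c t) '' S

end Families

/-!
The proof is Alexandrov reflection, carried out on the arrival time function instead of on the
moving hypersurfaces.

*The arrival time.* Since the velocity `ν / F` is transversal to `M_t`, the map `(t, p) ↦ φ t p`
is a local diffeomorphism (`IsExpandingFlow.exists_box`), and a connectedness argument shows that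
`Ω_b` is the disjoint union of `Ω_a` and of the region swept out in between
(`IsExpandingFoliation.domain_eq`). So the closure of `Ω_a` lies in `Ω_b` for `a < b`, the `M_t`
are pairwise disjoint, and the function `u` with `u = t` on `M_t` is smooth. The flow equation says
that `u` solves the degenerate elliptic equation `|∇u| = F(κ)`, where `κ` are the principal
curvatures of its level sets (`IsExpandingFlow.isLevelSetSolutionAt`).

*Reflection.* Let `R` be the reflection in a hyperplane bounding a closed half-space `H` that does
not meet the closure of `Ω_a`. Then `u ∘ R ≤ u` on `H` at later times
(`IsExpandingFoliation.map_mem_of_disjoint`). Otherwise, for a suitable time change `θ` with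
`θ' < 1`, the function `θ ∘ u ∘ R - u` has a positive maximum, which is not on the hyperplane
because `θ(t) ≤ t`. At this maximum the two gradients are parallel and the Hessians are ordered, so
by Weyl's monotonicity principle and the monotonicity of `F` the level set of `u` has the larger
`F(κ)`; but the gradients give it the smaller one, by the factor `θ' < 1`
(`not_isLocalMax_slowed_sub`). The factor `θ'` replaces the strong maximum principle and the Hopf
lemma, and `θ` is constant beyond some time, so that the maximum also exists where the reflected
point leaves the region under consideration.

*Conclusion.* If the flow comes out of `y`, every half-space at positive distance from `y` is
admissible for `H`. Letting the distance tend to zero, the closure of `Ω_t` is invariant under all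
reflections in hyperplanes through `y`, and a connected such domain having `y` in its closure is a
ball (`exists_frontier_eq_sphere`). A homothetically expanding flow comes out of the centre of
homothety, which gives the statement about solitons.
-/

/-! ### Connected sets and frontiers -/

/-- A preconnected set that meets both `s` and its complement meets the frontier of `s`. -/
lemma IsPreconnected.exists_mem_frontier {X : Type*} [TopologicalSpace X] {s t : Set X}
    (ht : IsPreconnected t) {x y : X} (hx : x ∈ t) (hxs : x ∈ s) (hy : y ∈ t) (hys : y ∉ s) :
    ∃ z ∈ t, z ∈ frontier s := by
  by_contra! hcon
  have hsub : t ⊆ interior s ∪ (closure s)ᶜ := fun z hz => by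
    by_cases h1 : z ∈ closure s
    · exact Or.inl (by_contra fun h2 => hcon z hz ⟨h1, h2⟩)
    · exact Or.inr h1
  have hxi : x ∈ interior s := (hsub hx).resolve_right fun h => h (subset_closure hxs)
  exact hys (interior_subset (ht.subset_left_of_subset_union isOpen_interior
    isClosed_closure.isOpen_compl
    (disjoint_compl_right.mono_left (interior_subset.trans subset_closure)) hsub ⟨x, hx, hxi⟩ hy))

/-! ### Monotonicity of the speed in the second fundamental form -/

section LinearAlgebra

variable {n : ℕ} {V : Type*} [NormedAddCommGroup V] [InnerProductSpace ℝ V]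

lemma orthonormal_cons {N : V} {e : Fin n → V} (hN : ‖N‖ = 1) (he : Orthonormal ℝ e)
    (hNe : ∀ i, inner ℝ N (e i) = 0) : Orthonormal ℝ (Fin.cons N e : Fin (n + 1) → V) := by
  constructor
  · intro i
    refine Fin.cases ?_ (fun i => ?_) i
    · simpa using hN
    · simpa using he.1 i
  · intro i j
    refine Fin.cases ?_ (fun i => ?_) i <;> refine Fin.cases ?_ (fun j => ?_) j
    · simp
    · intro _
      simpa using hNe j
    · intro _
      simpa [real_inner_comm] using hNe i
    · intro hij
      simpa using he.2 (fun h => hij (by rw [h]))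

lemma eq_inner_smul_add_sum (hV : Module.finrank ℝ V = n + 1) {N : V} {e : Fin n → V}
    (hN : ‖N‖ = 1) (he : Orthonormal ℝ e) (hNe : ∀ i, inner ℝ N (e i) = 0) (v : V) :
    v = inner ℝ N v • N + ∑ i, inner ℝ (e i) v • e i := by
  have ho := orthonormal_cons hN he hNe
  have hcard : Fintype.card (Fin (n + 1)) = Module.finrank ℝ V := by simp [hV]
  let B := basisOfOrthonormalOfCardEqFinrank ho hcard
  have hB : ⇑B = Fin.cons N e := coe_basisOfOrthonormalOfCardEqFinrank ho hcard
  let b := B.toOrthonormalBasis (by rw [hB]; exact ho)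
  have hb : ⇑b = Fin.cons N e := by rw [Module.Basis.coe_toOrthonormalBasis, hB]
  have := b.sum_repr' v
  rw [hb, Fin.sum_univ_succ] at this
  simpa using this.symm

lemma norm_sq_eq_sum_inner_sq (hV : Module.finrank ℝ V = n + 1) {N : V} {e : Fin n → V}
    (hN : ‖N‖ = 1) (he : Orthonormal ℝ e) (hNe : ∀ i, inner ℝ N (e i) = 0) {v : V}
    (hv : inner ℝ N v = 0) : ‖v‖ ^ 2 = ∑ i, inner ℝ (e i) v ^ 2 := by
  have h := congrArg (inner ℝ v) (eq_inner_smul_add_sum hV hN he hNe v)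
  rw [hv, zero_smul, zero_add, real_inner_self_eq_norm_sq, inner_sum] at h
  rw [h]
  refine Finset.sum_congr rfl fun i _ => ?_
  rw [inner_smul_right, real_inner_comm, sq]

variable [FiniteDimensional ℝ V]

/-- Weyl's monotonicity principle: if the quadratic form with eigenvalues `μ` (in the orthonormal
basis `f` of the hyperplane `Nᗮ`) is at most the one with eigenvalues `κ` (in the basis `e`),
then after a permutation `μ` is at most `κ`. -/
lemma exists_perm_le_of_forall_sum_le (hV : Module.finrank ℝ V = n + 1) {N : V} (hN : ‖N‖ = 1)
    {e f : Fin n → V} (he : Orthonormal ℝ e) (hf : Orthonormal ℝ f)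
    (hNe : ∀ i, inner ℝ N (e i) = 0) (hNf : ∀ i, inner ℝ N (f i) = 0) {κ μ : Fin n → ℝ}
    (hle : ∀ v, inner ℝ N v = 0 →
      ∑ i, μ i * inner ℝ (f i) v ^ 2 ≤ ∑ i, κ i * inner ℝ (e i) v ^ 2) :
    ∃ σ τ : Equiv.Perm (Fin n), μ ∘ τ ≤ κ ∘ σ := by
  -- the span of the directions of the `k + 1` smallest `κ` meets that of the `n - k` largest `μ`
  refine ⟨Tuple.sort κ, Tuple.sort μ, fun k => ?_⟩
  set σ := Tuple.sort κ
  set τ := Tuple.sort μ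
  have hσ : Monotone (κ ∘ σ) := Tuple.monotone_sort κ
  have hτ : Monotone (μ ∘ τ) := Tuple.monotone_sort μ
  have heσ : Orthonormal ℝ (e ∘ σ) := he.comp _ σ.injective
  have hfτ : Orthonormal ℝ (f ∘ τ) := hf.comp _ τ.injective
  let S := Submodule.span ℝ (range fun i : Iic k => e (σ i))
  let T := Submodule.span ℝ (range fun i : Ici k => f (τ i))
  have hS : Module.finrank ℝ S = k + 1 := by
    have h1 := (heσ.comp (fun i : Iic k => (i : Fin n)) Subtype.val_injective).linearIndependent
    have := finrank_span_eq_card h1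
    simpa [S, Function.comp_def] using this
  have hT : Module.finrank ℝ T = n - k := by
    have h1 := (hfτ.comp (fun i : Ici k => (i : Fin n)) Subtype.val_injective).linearIndependent
    have := finrank_span_eq_card h1
    simpa [T, Function.comp_def] using this
  have hSN : S ≤ (ℝ ∙ N)ᗮ := by
    rw [Submodule.span_le]
    rintro _ ⟨i, rfl⟩
    exact Submodule.mem_orthogonal_singleton_iff_inner_right.2 (hNe _)
  have hTN : T ≤ (ℝ ∙ N)ᗮ := by
    rw [Submodule.span_le]
    rintro _ ⟨i, rfl⟩
    exact Submodule.mem_orthogonal_singleton_iff_inner_right.2 (hNf _)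
  have hN0 : N ≠ 0 := fun h => by simp [h] at hN
  have hdim : Module.finrank ℝ ((ℝ ∙ N)ᗮ : Submodule ℝ V) = n := by
    have : Fact (Module.finrank ℝ V = n + 1) := ⟨hV⟩
    exact Submodule.finrank_orthogonal_span_singleton hN0
  have hsup : Module.finrank ℝ (S ⊔ T : Submodule ℝ V) ≤ n :=
    hdim ▸ Submodule.finrank_mono (sup_le hSN hTN)
  have hinf : S ⊓ T ≠ ⊥ := fun hbot => by
    have := Submodule.finrank_sup_add_finrank_inf_eq S T
    rw [hbot, finrank_bot, hS, hT] at this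
    have := k.2
    omega
  obtain ⟨v, ⟨hvS, hvT⟩, hv0⟩ := Submodule.exists_mem_ne_zero_of_ne_bot hinf
  have hvN : inner ℝ N v = 0 := Submodule.mem_orthogonal_singleton_iff_inner_right.1 (hSN hvS)
  have hve : ∀ i, k < i → inner ℝ (e (σ i)) v = 0 := fun i hi => by
    have : S ≤ (ℝ ∙ e (σ i))ᗮ := by
      rw [Submodule.span_le]
      rintro _ ⟨j, rfl⟩
      exact Submodule.mem_orthogonal_singleton_iff_inner_right.2
        (heσ.2 (fun hij => absurd j.2 (by rw [← hij]; simpa using hi)))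
    exact Submodule.mem_orthogonal_singleton_iff_inner_right.1 (this hvS)
  have hvf : ∀ i, i < k → inner ℝ (f (τ i)) v = 0 := fun i hi => by
    have : T ≤ (ℝ ∙ f (τ i))ᗮ := by
      rw [Submodule.span_le]
      rintro _ ⟨j, rfl⟩
      exact Submodule.mem_orthogonal_singleton_iff_inner_right.2
        (hfτ.2 (fun hij => absurd j.2 (by rw [← hij]; simpa using hi)))
    exact Submodule.mem_orthogonal_singleton_iff_inner_right.1 (this hvT)
  have h1 : ∑ i, κ i * inner ℝ (e i) v ^ 2 ≤ κ (σ k) * ‖v‖ ^ 2 := by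
    rw [norm_sq_eq_sum_inner_sq hV hN he hNe hvN, Finset.mul_sum,
      ← Equiv.sum_comp σ, ← Equiv.sum_comp σ (fun i => κ (σ k) * inner ℝ (e i) v ^ 2)]
    refine Finset.sum_le_sum fun i _ => ?_
    rcases le_or_gt i k with hik | hik
    · exact mul_le_mul_of_nonneg_right (hσ hik) (sq_nonneg _)
    · simp [hve i hik]
  have h2 : μ (τ k) * ‖v‖ ^ 2 ≤ ∑ i, μ i * inner ℝ (f i) v ^ 2 := by
    rw [norm_sq_eq_sum_inner_sq hV hN hf hNf hvN, Finset.mul_sum,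
      ← Equiv.sum_comp τ, ← Equiv.sum_comp τ (fun i => μ i * inner ℝ (f i) v ^ 2)]
    refine Finset.sum_le_sum fun i _ => ?_
    rcases le_or_gt k i with hik | hik
    · exact mul_le_mul_of_nonneg_right (hτ hik) (sq_nonneg _)
    · simp [hvf i hik]
  exact le_of_mul_le_mul_right (h2.trans ((hle v hvN).trans h1)) (by positivity)

end LinearAlgebra

lemma IsAdmissibleSpeed.mono {n : ℕ} {Γ : Set (Fin n → ℝ)} {F : (Fin n → ℝ) → ℝ}
    (hF : IsAdmissibleSpeed Γ F) {x y : Fin n → ℝ} (hx : x ∈ Γ) (hy : y ∈ Γ) (hxy : x ≤ y) :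
    F x ≤ F y := by
  have hmem : ∀ s ∈ Icc (0 : ℝ) 1, x + s • (y - x) ∈ Γ := fun s hs =>
    hF.convex.add_smul_sub_mem hx hy hs
  have hder : ∀ s ∈ Icc (0 : ℝ) 1, HasDerivAt (fun s : ℝ => F (x + s • (y - x)))
      (fderiv ℝ F (x + s • (y - x)) (y - x)) s := fun s hs => by
    have h1 : DifferentiableAt ℝ F (x + s • (y - x)) :=
      (hF.smooth.contDiffAt (hF.isOpen.mem_nhds (hmem s hs))).differentiableAt (by simp)
    have h2 : HasDerivAt (fun s : ℝ => x + s • (y - x)) (y - x) s := by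
      simpa using ((hasDerivAt_id s).smul_const (y - x)).const_add x
    exact h1.hasFDerivAt.comp_hasDerivAt s h2
  have hmono : MonotoneOn (fun s : ℝ => F (x + s • (y - x))) (Icc 0 1) := by
    refine monotoneOn_of_deriv_nonneg (convex_Icc 0 1)
      (fun s hs => (hder s hs).continuousAt.continuousWithinAt)
      (fun s hs => (hder s (interior_subset hs)).differentiableAt.differentiableWithinAt)
      fun s hs => ?_
    have hs' := interior_subset hs
    rw [(hder s hs').deriv]
    have : y - x = ∑ i, (y - x) i • (Pi.single i 1 : Fin n → ℝ) := by
      ext j; simp [Pi.single_apply]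
    rw [this, map_sum]
    refine Finset.sum_nonneg fun i _ => ?_
    rw [← this, map_smul]
    exact mul_nonneg (sub_nonneg.2 (hxy i)) (hF.partial_pos _ (hmem s hs') i).le
  simpa using hmono (left_mem_Icc.2 zero_le_one) (right_mem_Icc.2 zero_le_one) zero_le_one

/-- The speed function is monotone under the order of second fundamental forms. -/
lemma IsAdmissibleSpeed.le_of_forall_sum_le {n : ℕ} {Γ : Set (Fin n → ℝ)} {F : (Fin n → ℝ) → ℝ}
    (hF : IsAdmissibleSpeed Γ F) {V : Type*} [NormedAddCommGroup V] [InnerProductSpace ℝ V]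
    [FiniteDimensional ℝ V] (hV : Module.finrank ℝ V = n + 1) {N : V} (hN : ‖N‖ = 1)
    {e f : Fin n → V} (he : Orthonormal ℝ e) (hf : Orthonormal ℝ f)
    (hNe : ∀ i, inner ℝ N (e i) = 0) (hNf : ∀ i, inner ℝ N (f i) = 0) {κ μ : Fin n → ℝ}
    (hκ : κ ∈ Γ) (hμ : μ ∈ Γ)
    (hle : ∀ v, inner ℝ N v = 0 →
      ∑ i, μ i * inner ℝ (f i) v ^ 2 ≤ ∑ i, κ i * inner ℝ (e i) v ^ 2) : F μ ≤ F κ := by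
  obtain ⟨σ, τ, h⟩ := exists_perm_le_of_forall_sum_le hV hN he hf hNe hNf hle
  rw [← hF.symm σ κ hκ, ← hF.symm τ μ hμ]
  exact hF.mono (hF.symm_cone τ μ hμ) (hF.symm_cone σ κ hκ) h

/-! ### One-variable calculus -/

section Calculus

lemma deriv_deriv_nonpos_of_isLocalMax {g : ℝ → ℝ} {x : ℝ} (h : IsLocalMax g x)
    (hg : ContinuousAt g x) : deriv (deriv g) x ≤ 0 := by
  by_contra! hpos
  have hmin := isLocalMin_of_deriv_deriv_pos hpos h.deriv_eq_zero hg
  have hconst : g =ᶠ[𝓝 x] fun _ => g x := by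
    filter_upwards [h, hmin] with s h1 h2 using le_antisymm h1 h2
  have h1 := hconst.deriv.deriv_eq
  simp at h1
  exact hpos.ne' h1

/-- Second derivative test at a maximum of `θ ∘ β - α`, at a critical point of `β`. -/
lemma mul_le_of_isLocalMax_comp_sub {θ θ' α α' β β' : ℝ → ℝ} {α₂ β₂ : ℝ}
    (hθ : ∀ t, HasDerivAt θ (θ' t) t) (hθ' : Differentiable ℝ θ')
    (hα : ∀ᶠ s in 𝓝 0, HasDerivAt α (α' s) s) (hα' : HasDerivAt α' α₂ 0)
    (hβ : ∀ᶠ s in 𝓝 0, HasDerivAt β (β' s) s) (hβ' : HasDerivAt β' β₂ 0) (hβ0 : β' 0 = 0)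
    (hmax : IsLocalMax (fun s => θ (β s) - α s) 0) : θ' (β 0) * β₂ ≤ α₂ := by
  have h1 : ∀ᶠ s in 𝓝 0, HasDerivAt (fun s => θ (β s) - α s) (θ' (β s) * β' s - α' s) s := by
    filter_upwards [hα, hβ] with s hsα hsβ using ((hθ _).comp s hsβ).sub hsα
  have h2 : deriv (fun s => θ (β s) - α s) =ᶠ[𝓝 0] fun s => θ' (β s) * β' s - α' s := by
    filter_upwards [h1] with s hs using hs.deriv
  have h3 : HasDerivAt (fun s => θ' (β s) * β' s - α' s) (θ' (β 0) * β₂ - α₂) 0 := by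
    have : HasDerivAt (fun s => θ' (β s) * β' s - α' s) _ 0 :=
      (((hθ' (β 0)).hasDerivAt.comp 0 hβ.self_of_nhds).mul hβ').sub hα'
    convert this using 1
    simp [hβ0]
  have h4 := deriv_deriv_nonpos_of_isLocalMax hmax h1.self_of_nhds.continuousAt
  rw [h2.deriv_eq, h3.deriv] at h4
  linarith

/-- A smooth time change that is strictly slower than the identity, stops at time `b`, and still
reaches `τ` before time `σ`. -/
lemma exists_slow_time_change {a τ σ b : ℝ} (haτ : a ≤ τ) (hτσ : τ < σ) (hσb : σ < b) :
    ∃ θ θ' : ℝ → ℝ, (∀ t, HasDerivAt θ (θ' t) t) ∧ Differentiable ℝ θ' ∧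
      (∀ t, 0 ≤ θ' t ∧ θ' t < 1) ∧ θ a = a ∧ (∀ t, a ≤ t → θ t ≤ t) ∧
      (∀ t, b ≤ t → θ t = θ b) ∧ τ < θ σ := by
  obtain ⟨c, hc1, hc2⟩ : ∃ c, (τ - a) / (σ - a) < c ∧ c < 1 :=
    exists_between ((div_lt_one (by linarith)).2 (by linarith))
  have hc0 : 0 ≤ c := (div_nonneg (by linarith) (by linarith)).trans hc1.le
  let χ : ℝ → ℝ := fun t => c * (1 - Real.smoothTransition ((t - σ) / (b - σ)))
  have hχd : Differentiable ℝ χ := by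
    have : ContDiff ℝ 1 χ := by
      refine contDiff_const.mul (contDiff_const.sub (Real.smoothTransition.contDiff.comp ?_))
      exact (contDiff_id.sub contDiff_const).div_const _
    exact this.differentiable (by simp)
  have hχ : ∀ t, 0 ≤ χ t ∧ χ t < 1 := fun t => by
    have h0 := Real.smoothTransition.nonneg ((t - σ) / (b - σ))
    have h1 := Real.smoothTransition.le_one ((t - σ) / (b - σ))
    constructor
    · exact mul_nonneg hc0 (by linarith)
    · simp only [χ]; nlinarith
  let θ : ℝ → ℝ := fun t => a + ∫ x in a..t, χ x
  have hθ : ∀ t, HasDerivAt θ (χ t) t := fun t =>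
    (intervalIntegral.integral_hasDerivAt_right (hχd.continuous.intervalIntegrable _ _)
      (hχd.continuous.stronglyMeasurableAtFilter _ _) hχd.continuous.continuousAt).const_add a
  have hθa : θ a = a := by simp [θ]
  refine ⟨θ, χ, hθ, hχd, hχ, hθa, fun t hat => ?_, fun t hbt => ?_, ?_⟩
  · have hanti : Antitone fun t => θ t - t := by
      refine antitone_of_hasDerivAt_nonpos (fun t => (hθ t).sub (hasDerivAt_id t)) fun t => ?_
      simpa using (hχ t).2.le
    have := hanti hat
    simp only [hθa] at this
    linarith
  · have : ∫ x in b..t, χ x = 0 := by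
      rw [intervalIntegral.integral_congr (g := fun _ => 0), intervalIntegral.integral_zero]
      intro x hx
      rw [uIcc_of_le hbt] at hx
      have : 1 ≤ (x - σ) / (b - σ) := by
        rw [le_div_iff₀ (by linarith)]; linarith [hx.1]
      simp [χ, Real.smoothTransition.one_of_one_le this]
    simp only [θ]
    rw [← intervalIntegral.integral_add_adjacent_intervals (b := b)
      (hχd.continuous.intervalIntegrable _ _) (hχd.continuous.intervalIntegrable _ _), this,
      add_zero]
  · have : ∫ x in a..σ, χ x = (σ - a) * c := by
      rw [intervalIntegral.integral_congr (g := fun _ => c), intervalIntegral.integral_const,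
        smul_eq_mul]
      intro x hx
      rw [uIcc_of_le (by linarith)] at hx
      have : (x - σ) / (b - σ) ≤ 0 := div_nonpos_of_nonpos_of_nonneg (by linarith [hx.2])
        (by linarith)
      simp [χ, Real.smoothTransition.zero_of_nonpos this]
    simp only [θ, this]
    rw [div_lt_iff₀ (by linarith)] at hc1
    linarith

end Calculus

/-! ### Recognising spheres -/

section Spheres

variable {V : Type*} [NormedAddCommGroup V] [NormedSpace ℝ V]

/-- A bounded set with frontier in a ball around `y` is contained in that ball: rays starting at
outside points would leave the set through the frontier. -/
lemma dist_lt_of_frontier_subset_ball {Ω : Set V} (hΩ : Bornology.IsBounded Ω) {y : V} {r : ℝ}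
    (hfr : frontier Ω ⊆ Metric.ball y r) (hr : 0 < r) : Ω ⊆ Metric.ball y r := by
  intro x hx
  by_contra hxr
  rw [Metric.mem_ball, not_lt, dist_eq_norm] at hxr
  obtain ⟨R, hR⟩ := hΩ.subset_ball y
  have hray : IsPreconnected ((fun s : ℝ => y + s • (x - y)) '' Ici 1) :=
    isPreconnected_Ici.image _ (by fun_prop)
  have hxn : 0 < ‖x - y‖ := hr.trans_le hxr
  set s := max 1 (R / ‖x - y‖)
  have hs1 : 1 ≤ s := le_max_left _ _
  have hout : y + s • (x - y) ∉ Ω := fun hmem => by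
    have := hR hmem
    rw [Metric.mem_ball, dist_eq_norm, add_sub_cancel_left, norm_smul, Real.norm_eq_abs,
      abs_of_pos (by linarith), ← lt_div_iff₀ hxn] at this
    exact absurd this (not_lt.2 (le_max_right _ _))
  obtain ⟨_, ⟨q, hq, rfl⟩, hzf⟩ := hray.exists_mem_frontier ⟨1, self_mem_Ici, by simp⟩ hx
    ⟨s, hs1, rfl⟩ hout
  have := hfr hzf
  rw [Metric.mem_ball, dist_eq_norm, add_sub_cancel_left, norm_smul, Real.norm_eq_abs,
    abs_of_pos (by linarith [mem_Ici.1 hq])] at this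
  nlinarith [mem_Ici.1 hq]

/-- A rotationally symmetric bounded domain whose closure contains the centre is bounded by a
sphere. The assumption `hfr` excludes the punctured ball. -/
lemma exists_frontier_eq_sphere [Nontrivial V] [ProperSpace V] {Ω : Set V} (hΩo : IsOpen Ω)
    (hΩc : IsConnected Ω) (hΩb : Bornology.IsBounded Ω) {y : V} (hy : y ∈ closure Ω)
    (hrot : ∀ x ∈ Ω, ∀ x', dist x' y = dist x y → x' ∈ closure Ω)
    (hfr : ∀ x ∈ frontier Ω, x ∉ interior (closure Ω)) :
    ∃ ρ : ℝ, 0 < ρ ∧ frontier Ω = Metric.sphere y ρ := by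
  have hcpt : IsCompact (closure Ω) := hΩb.isCompact_closure
  obtain ⟨x₁, hx₁, hmax⟩ := hcpt.exists_isMaxOn ⟨y, hy⟩
    (continuous_id.dist (continuous_const (y := y))).continuousOn
  set ρ := dist x₁ y with hρ
  have hsub : closure Ω ⊆ Metric.closedBall y ρ := fun x hx => hmax hx
  have hΩball : Ω ⊆ Metric.ball y ρ := by
    rw [← interior_closedBall' y ρ]
    exact interior_maximal (subset_closure.trans hsub) hΩo
  have hρ0 : 0 < ρ := by
    obtain ⟨x, hx⟩ := hΩc.nonempty
    exact dist_nonneg.trans_lt (hΩball hx)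
  have hball : Metric.ball y ρ ⊆ closure Ω := by
    intro x hx
    rcases eq_or_ne x y with rfl | hne
    · exact hy
    have hd : 0 < dist x y := dist_pos.2 hne
    obtain ⟨z₁, hz₁, h1⟩ := Metric.mem_closure_iff.1 hy _ hd
    obtain ⟨z₂, hz₂, h2⟩ := Metric.mem_closure_iff.1 hx₁ (ρ - dist x y) (sub_pos.2 hx)
    have h3 : dist x y < dist z₂ y := by
      have := dist_triangle x₁ z₂ y
      linarith
    obtain ⟨z, hz, hzx⟩ := hΩc.isPreconnected.intermediate_value hz₁ hz₂
      (f := fun z => dist z y) (by fun_prop) ⟨by rw [dist_comm]; exact h1.le, h3.le⟩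
    exact hrot z hz x hzx.symm
  have hcl : closure Ω = Metric.closedBall y ρ :=
    hsub.antisymm (by
      rw [← closure_ball y hρ0.ne']
      exact closure_minimal hball isClosed_closure)
  refine ⟨ρ, hρ0, Subset.antisymm (fun x hx => ?_) fun x hx => ?_⟩
  · have h1 := hfr x hx
    rw [hcl, interior_closedBall y hρ0.ne', Metric.mem_ball, not_lt] at h1
    exact le_antisymm (hsub (frontier_subset_closure hx)) h1
  · rw [hΩo.frontier_eq]
    exact ⟨hcl ▸ Metric.sphere_subset_closedBall hx, fun hxΩ => (hΩball hxΩ).ne hx⟩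

end Spheres

/-! ### Families of hypersurfaces bounding growing domains -/

/-- The family of hypersurfaces `φ t (M)`, `t ∈ I`, with normal field `ν` bounds the domains `Ω t`,
and near each of its points it is a local foliation of the ambient space: `box` provides a smooth
local time function `x ↦ (e.symm x).1`, which increases in the direction of `ν`, and `side` says
that `ν` points out of `Ω t`. That the family is globally a foliation is a consequence, not an
assumption. -/
structure IsExpandingFoliation {n : ℕ} {M : Type*} [TopologicalSpace M] (I : Set ℝ)
    (φ : ℝ → M → EuclideanSpace ℝ (Fin (n + 1))) (ν : ℝ → M → EuclideanSpace ℝ (Fin (n + 1)))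
    (Ω : ℝ → Set (EuclideanSpace ℝ (Fin (n + 1)))) : Prop where
  ordConnected : I.OrdConnected
  domain : ∀ t ∈ I, IsEnclosedDomain (Ω t) (range (φ t))
  injective : ∀ t ∈ I, Function.Injective (φ t)
  side : ∀ t ∈ I, ∀ p : M, ∀ᶠ s in 𝓝[>] (0 : ℝ),
    φ t p - s • ν t p ∈ Ω t ∧ φ t p + s • ν t p ∉ closure (Ω t)
  box : ∀ t ∈ I, ∀ p : M, ∃ e : OpenPartialHomeomorph (ℝ × M) (EuclideanSpace ℝ (Fin (n + 1))),
    (t, p) ∈ e.source ∧ (∀ q ∈ e.source, q.1 ∈ I ∧ e q = φ q.1 q.2) ∧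
    ContDiffAt ℝ ∞ (fun x => (e.symm x).1) (φ t p) ∧
    0 < fderiv ℝ (fun x => (e.symm x).1) (φ t p) (ν t p)

namespace IsExpandingFoliation

variable {n : ℕ} {M : Type*} [TopologicalSpace M] {I : Set ℝ}
  {φ ν : ℝ → M → EuclideanSpace ℝ (Fin (n + 1))}
  {Ω : ℝ → Set (EuclideanSpace ℝ (Fin (n + 1)))}

lemma isOpen_time (h : IsExpandingFoliation I φ ν Ω) [Nonempty M] : IsOpen I := by
  rw [isOpen_iff_mem_nhds]
  intro t ht
  obtain ⟨p⟩ := ‹Nonempty M›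
  obtain ⟨e, hmem, he, -⟩ := h.box t ht p
  have h1 : ContinuousAt (fun s : ℝ => (s, p)) t := by fun_prop
  filter_upwards [h1.preimage_mem_nhds (e.open_source.mem_nhds hmem)] with s hs
  exact (he _ hs).1

lemma continuousAt (h : IsExpandingFoliation I φ ν Ω) {t : ℝ} (ht : t ∈ I) (p : M) :
    ContinuousAt (fun q : ℝ × M => φ q.1 q.2) (t, p) := by
  obtain ⟨e, hmem, he, -⟩ := h.box t ht p
  refine (e.continuousAt hmem).congr ?_
  filter_upwards [e.open_source.mem_nhds hmem] with q hq using (he q hq).2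

/-- The flow map sends neighbourhoods to neighbourhoods. -/
lemma image_mem_nhds (h : IsExpandingFoliation I φ ν Ω) {t : ℝ} (ht : t ∈ I) (p : M)
    {W : Set (ℝ × M)} (hW : W ∈ 𝓝 (t, p)) :
    (fun q : ℝ × M => φ q.1 q.2) '' W ∈ 𝓝 (φ t p) := by
  obtain ⟨e, hmem, he, -⟩ := h.box t ht p
  have h1 := e.image_mem_nhds hmem (inter_mem hW (e.open_source.mem_nhds hmem))
  rw [(he _ hmem).2] at h1
  refine mem_of_superset h1 ?_
  rintro _ ⟨q, hq, rfl⟩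
  exact ⟨q, hq.1, ((he q hq.2).2).symm⟩

/-- Moving along the normal increases time to first order; this ties the two sides of `M_t`
singled out by `ν` to later and earlier times. -/
lemma exists_near (h : IsExpandingFoliation I φ ν Ω) {t : ℝ} (ht : t ∈ I) (p : M)
    {W : Set (ℝ × M)} (hW : W ∈ 𝓝 (t, p)) :
    (∃ q ∈ W, t < q.1 ∧ φ q.1 q.2 ∉ closure (Ω t)) ∧ ∃ q ∈ W, q.1 < t ∧ φ q.1 q.2 ∈ Ω t := by
  obtain ⟨e, hmem, he, hsm, hpos⟩ := h.box t ht p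
  have hx : e (t, p) = φ t p := (he _ hmem).2
  have hxt : φ t p ∈ e.target := hx ▸ e.map_source hmem
  have hsymm : e.symm (φ t p) = (t, p) := by rw [← hx, e.left_inv hmem]
  set u : EuclideanSpace ℝ (Fin (n + 1)) → ℝ := fun x => (e.symm x).1 with hu
  have hdu : HasFDerivAt u (fderiv ℝ u (φ t p)) (φ t p) :=
    (hsm.differentiableAt (by simp)).hasFDerivAt
  have hline : HasDerivAt (fun s : ℝ => φ t p + s • ν t p) (ν t p) 0 := by
    simpa using ((hasDerivAt_id (0 : ℝ)).smul_const (ν t p)).const_add (φ t p)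
  have hder : HasDerivAt (fun s : ℝ => u (φ t p + s • ν t p)) (fderiv ℝ u (φ t p) (ν t p)) 0 := by
    have : HasFDerivAt u (fderiv ℝ u (φ t p)) (φ t p + (0 : ℝ) • ν t p) := by simpa using hdu
    exact this.comp_hasDerivAt 0 hline
  have hu0 : u (φ t p + (0 : ℝ) • ν t p) = t := by simp [hu, hsymm]
  have hcont : ∀ᶠ s in 𝓝 (0 : ℝ), φ t p + s • ν t p ∈ e.target ∧
      e.symm (φ t p + s • ν t p) ∈ W := by
    have c1 : Tendsto (fun s : ℝ => φ t p + s • ν t p) (𝓝 0) (𝓝 (φ t p)) := by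
      simpa using hline.continuousAt.tendsto
    have c2 := (e.continuousAt_symm hxt).tendsto.comp c1
    rw [hsymm] at c2
    exact (c1.eventually (e.open_target.mem_nhds hxt)).and (c2.eventually hW)
  have hslope := hder.tendsto_slope
  have hsgn : ∀ᶠ s in 𝓝[≠] (0 : ℝ), 0 < slope (fun s : ℝ => u (φ t p + s • ν t p)) 0 s :=
    hslope.eventually (lt_mem_nhds hpos)
  have key : ∀ y ∈ e.target, φ (e.symm y).1 (e.symm y).2 = y := fun y hy => by
    rw [← (he _ (e.map_target hy)).2, e.right_inv hy]
  have hgt : 𝓝[>] (0 : ℝ) ≤ 𝓝[≠] 0 := nhdsWithin_mono _ fun s hs => ne_of_gt hs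
  have hlt : 𝓝[<] (0 : ℝ) ≤ 𝓝[≠] 0 := nhdsWithin_mono _ fun s hs => ne_of_lt hs
  constructor
  · obtain ⟨s, ⟨⟨hs1, hs2⟩, hs3⟩, hs4, hs5⟩ := (((h.side t ht p).and (hsgn.filter_mono hgt)).and
      ((hcont.filter_mono nhdsWithin_le_nhds).and self_mem_nhdsWithin)).exists
    refine ⟨_, hs4.2, ?_, ?_⟩
    · have hs5' : (0:ℝ) < s := hs5
      rw [slope_def_field, hu0, div_pos_iff_of_pos_right (by linarith)] at hs3
      simpa [hu] using hs3
    · rw [key _ hs4.1]; exact hs2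
  · have hneg : Tendsto (fun s : ℝ => -s) (𝓝[>] 0) (𝓝[<] 0) := by
      simpa using tendsto_neg_nhdsGT (a := (0 : ℝ))
    obtain ⟨s, ⟨⟨hs1, hs2⟩, hs3⟩, hs4, hs5⟩ := (((h.side t ht p).and
      (hneg.eventually (hsgn.filter_mono hlt))).and
      ((hneg.eventually (hcont.filter_mono nhdsWithin_le_nhds)).and self_mem_nhdsWithin)).exists
    refine ⟨_, hs4.2, ?_, ?_⟩
    · have hs5' : (0:ℝ) < s := hs5
      rw [slope_def_field, hu0] at hs3
      have := (div_pos_iff.1 hs3).resolve_left (fun hh => by linarith [hh.2])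
      simpa [hu] using this.1
    · rw [key _ hs4.1]
      simpa [sub_eq_add_neg] using hs1

/-- The flow map is injective for times close to a given one. -/
lemma exists_injOn (h : IsExpandingFoliation I φ ν Ω) [CompactSpace M] {t : ℝ} (ht : t ∈ I) :
    ∃ ε > 0, InjOn (fun q : ℝ × M => φ q.1 q.2) (Ioo (t - ε) (t + ε) ×ˢ univ) := by
  have hK : IsCompact (({t} : Set ℝ) ×ˢ (univ : Set M)) := isCompact_singleton.prod isCompact_univ
  have hinj : InjOn (fun q : ℝ × M => φ q.1 q.2) (({t} : Set ℝ) ×ˢ (univ : Set M)) := by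
    rintro ⟨a, p⟩ ⟨ha, -⟩ ⟨b, q⟩ ⟨hb, -⟩ hab
    obtain rfl : a = t := ha
    obtain rfl : b = a := hb
    exact Prod.ext rfl (h.injective _ ht hab)
  obtain ⟨T, hT, hTi⟩ := hinj.exists_mem_nhdsSet hK
    (by
      rintro ⟨a, p⟩ ⟨ha, -⟩
      obtain rfl : a = t := ha
      exact h.continuousAt ht p)
    (by
      rintro ⟨a, p⟩ ⟨ha, -⟩
      obtain rfl : a = t := ha
      obtain ⟨e, hmem, he, -⟩ := h.box _ ht p
      exact ⟨e.source, e.open_source.mem_nhds hmem, fun x hx y hy hxy =>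
        e.injOn hx hy (by rw [(he x hx).2, (he y hy).2]; exact hxy)⟩)
  obtain ⟨V, hVo, hKV, hVT⟩ := mem_nhdsSet_iff_exists.1 hT
  obtain ⟨A, B, hA, hB, htA, hB', hAB⟩ :=
    generalized_tube_lemma isCompact_singleton isCompact_univ hVo hKV
  obtain ⟨ε, hε, hball⟩ := Metric.isOpen_iff.1 hA t (htA rfl)
  refine ⟨ε, hε, hTi.mono (subset_trans ?_ (hAB.trans hVT))⟩
  rw [← Real.ball_eq_Ioo]
  exact prod_mono hball hB'


lemma isPreconnected_image (h : IsExpandingFoliation I φ ν Ω) {J : Set ℝ} (hJ : IsPreconnected J)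
    (hJI : J ⊆ I) {B : Set M} (hB : IsPreconnected B) :
    IsPreconnected ((fun q : ℝ × M => φ q.1 q.2) '' (J ×ˢ B)) :=
  (hJ.prod hB).image _ fun q hq => (h.continuousAt (hJI hq.1) q.2).continuousWithinAt

section Step

variable [LocallyConnectedSpace M] {c d a b : ℝ}

/-- Later hypersurfaces are outside `Ω a`: they are joined to points outside `closure (Ω a)` by a
connected set that injectivity keeps away from the frontier. -/
lemma notMem_closure_of_injOn (h : IsExpandingFoliation I φ ν Ω) (hcd : Ioo c d ⊆ I)
    (hinj : InjOn (fun q : ℝ × M => φ q.1 q.2) (Ioo c d ×ˢ univ)) (ha : a ∈ Ioo c d)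
    (hb : b ∈ Ioo a d) (p : M) : φ b p ∉ closure (Ω a) := by
  obtain ⟨B, -, hBo, hpB, hBc⟩ := locallyConnectedSpace_iff_subsets_isOpen_isConnected.1 ‹_› p
    univ univ_mem
  have hW : Ioo c d ×ˢ B ∈ 𝓝 (a, p) := (isOpen_Ioo.prod hBo).mem_nhds ⟨ha, hpB⟩
  obtain ⟨⟨q, hqW, haq, hq⟩, -⟩ := h.exists_near (hcd ha) p hW
  have hsub : Ioo a d ⊆ Ioo c d := Ioo_subset_Ioo_left ha.1.le
  have hpre := h.isPreconnected_image isPreconnected_Ioo (hsub.trans hcd) hBc.isPreconnected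
  intro hmem
  obtain ⟨_, ⟨r, hr, rfl⟩, hfr⟩ := hpre.exists_mem_frontier
    ⟨(b, p), ⟨hb, hpB⟩, rfl⟩ hmem ⟨q, ⟨⟨haq, hqW.1.2⟩, hqW.2⟩, rfl⟩ hq
  obtain ⟨p', hp'⟩ := ((h.domain a (hcd ha)).frontier_eq ▸ frontier_closure_subset hfr :
    φ r.1 r.2 ∈ range (φ a))
  have := hinj (x₁ := (a, p')) (x₂ := r) ⟨ha, trivial⟩ ⟨hsub hr.1, trivial⟩ hp'
  exact hr.1.1.ne (congrArg Prod.fst this)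

/-- Earlier hypersurfaces are inside `Ω b`. -/
lemma mem_of_injOn (h : IsExpandingFoliation I φ ν Ω) (hcd : Ioo c d ⊆ I)
    (hinj : InjOn (fun q : ℝ × M => φ q.1 q.2) (Ioo c d ×ˢ univ)) (hb : b ∈ Ioo c d)
    (ha : a ∈ Ioo c b) (p : M) : φ a p ∈ Ω b := by
  obtain ⟨B, -, hBo, hpB, hBc⟩ := locallyConnectedSpace_iff_subsets_isOpen_isConnected.1 ‹_› p
    univ univ_mem
  have hW : Ioo c d ×ˢ B ∈ 𝓝 (b, p) := (isOpen_Ioo.prod hBo).mem_nhds ⟨hb, hpB⟩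
  obtain ⟨-, q, hqW, haq, hq⟩ := h.exists_near (hcd hb) p hW
  have hsub : Ioo c b ⊆ Ioo c d := Ioo_subset_Ioo_right hb.2.le
  have hpre := h.isPreconnected_image isPreconnected_Ioo (hsub.trans hcd) hBc.isPreconnected
  by_contra hmem
  obtain ⟨_, ⟨r, hr, rfl⟩, hfr⟩ := hpre.exists_mem_frontier
    ⟨q, ⟨⟨hqW.1.1, haq⟩, hqW.2⟩, rfl⟩ hq ⟨(a, p), ⟨ha, hpB⟩, rfl⟩ hmem
  obtain ⟨p', hp'⟩ := ((h.domain b (hcd hb)).frontier_eq ▸ hfr : φ r.1 r.2 ∈ range (φ b))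
  have := hinj (x₁ := (b, p')) (x₂ := r) ⟨hb, trivial⟩ ⟨hsub hr.1, trivial⟩ hp'
  exact hr.1.2.ne' (congrArg Prod.fst this)

/-- Between two close times, the domain grows exactly by the region swept out. -/
lemma domain_eq_of_injOn (h : IsExpandingFoliation I φ ν Ω) [CompactSpace M] [Nonempty M]
    (hcd : Ioo c d ⊆ I) (hinj : InjOn (fun q : ℝ × M => φ q.1 q.2) (Ioo c d ×ˢ univ))
    (hca : c < a) (hab : a < b) (hbd : b < d) :
    Ω b = Ω a ∪ (fun q : ℝ × M => φ q.1 q.2) '' (Ico a b ×ˢ univ) := by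
  have haI : a ∈ I := hcd ⟨hca, hab.trans hbd⟩
  have hbI : b ∈ I := hcd ⟨hca.trans hab, hbd⟩
  have hDa := h.domain a haI
  have hDb := h.domain b hbI
  set W := Ω a ∪ (fun q : ℝ × M => φ q.1 q.2) '' (Ico a b ×ˢ univ) with hW
  have hbot : ∀ p, φ a p ∈ W := fun p => Or.inr ⟨(a, p), ⟨⟨le_rfl, hab⟩, trivial⟩, rfl⟩
  -- `W` is a connected open set with frontier in `M_b`, hence a component of the complement of
  -- `M_b`, and it meets the component `Ω b`
  have hWo : IsOpen W := by
    rw [isOpen_iff_mem_nhds]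
    rintro x (hx | ⟨⟨t, p⟩, ⟨ht, -⟩, rfl⟩)
    · exact mem_of_superset (hDa.isOpen.mem_nhds hx) subset_union_left
    · have hN : Ioo c b ×ˢ (univ : Set M) ∈ 𝓝 (t, p) :=
        (isOpen_Ioo.prod isOpen_univ).mem_nhds ⟨⟨hca.trans_le ht.1, ht.2⟩, trivial⟩
      refine mem_of_superset
        (h.image_mem_nhds (hcd ⟨hca.trans_le ht.1, ht.2.trans hbd⟩) p hN) ?_
      rintro _ ⟨⟨s, q⟩, ⟨hs, -⟩, rfl⟩
      rcases lt_or_ge s a with hsa | hsa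
      · exact Or.inl (h.mem_of_injOn hcd hinj ⟨hca, hab.trans hbd⟩ ⟨hs.1, hsa⟩ q)
      · exact Or.inr ⟨(s, q), ⟨⟨hsa, hs.2⟩, trivial⟩, rfl⟩
  have hWfr : frontier W ⊆ range (φ b) := by
    have hcpt : IsCompact ((fun q : ℝ × M => φ q.1 q.2) '' (Icc a b ×ˢ univ)) :=
      (isCompact_Icc.prod isCompact_univ).image_of_continuousOn fun q hq =>
        (h.continuousAt (hcd ⟨hca.trans_le hq.1.1, hq.1.2.trans_lt hbd⟩) q.2).continuousWithinAt
    have hcl : closure W ⊆ closure (Ω a) ∪ (fun q : ℝ × M => φ q.1 q.2) '' (Icc a b ×ˢ univ) := by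
      refine closure_minimal (union_subset_union subset_closure
        (image_mono (prod_mono_left Ico_subset_Icc_self))) (isClosed_closure.union hcpt.isClosed)
    intro x hx
    rw [hWo.frontier_eq] at hx
    rcases hcl hx.1 with hxa | ⟨⟨t, p⟩, ⟨ht, -⟩, rfl⟩
    · rw [closure_eq_self_union_frontier, hDa.frontier_eq] at hxa
      rcases hxa with hxa | ⟨p, rfl⟩
      · exact absurd (Or.inl hxa) hx.2
      · exact absurd (hbot p) hx.2
    · rcases ht.2.lt_or_eq with htb | rfl
      · exact absurd (Or.inr ⟨(t, p), ⟨⟨ht.1, htb⟩, trivial⟩, rfl⟩) hx.2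
      · exact ⟨p, rfl⟩
  have hWdisj : ∀ p, φ b p ∉ W := by
    rintro p (hx | ⟨⟨t, q⟩, ⟨ht, -⟩, hq⟩)
    · exact h.notMem_closure_of_injOn hcd hinj ⟨hca, hab.trans hbd⟩ ⟨hab, hbd⟩ p
        (subset_closure hx)
    · have := hinj (x₁ := (t, q)) (x₂ := (b, p))
        ⟨⟨hca.trans_le ht.1, ht.2.trans hbd⟩, trivial⟩ ⟨⟨hca.trans hab, hbd⟩, trivial⟩ hq
      exact ht.2.ne (congrArg Prod.fst this)
  have hWc : IsPreconnected W := by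
    obtain ⟨x₀, hx₀⟩ := hDa.isConnected.nonempty
    refine isPreconnected_of_forall x₀ ?_
    rintro _ (hx | ⟨⟨t, p⟩, ⟨ht, -⟩, rfl⟩)
    · exact ⟨Ω a, subset_union_left, hx₀, hx, hDa.isConnected.isPreconnected⟩
    · have h1 : IsPreconnected (insert (φ a p) (Ω a)) :=
        hDa.isConnected.isPreconnected.subset_closure (subset_insert _ _)
          (insert_subset (frontier_subset_closure (hDa.frontier_eq ▸ mem_range_self p))
            subset_closure)
      have h2 := h.isPreconnected_image (J := Ico a b) isPreconnected_Ico
        (fun s hs => hcd ⟨hca.trans_le hs.1, hs.2.trans hbd⟩) (isPreconnected_singleton (x := p))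
      have hap : φ a p ∈ (fun q : ℝ × M => φ q.1 q.2) '' (Ico a b ×ˢ {p}) :=
        ⟨(a, p), ⟨⟨le_rfl, hab⟩, rfl⟩, rfl⟩
      have h3 := h1.union (φ a p) (mem_insert _ _) hap h2
      refine ⟨_, ?_, ?_, ?_, h3⟩
      · refine union_subset (insert_subset (hbot p) subset_union_left) ?_
        exact (image_mono (prod_mono_right (subset_univ _))).trans subset_union_right
      · exact Or.inl (mem_insert_of_mem _ hx₀)
      · exact Or.inr ⟨(t, p), ⟨ht, rfl⟩, rfl⟩
  obtain ⟨p₀⟩ := ‹Nonempty M›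
  have hmeet : φ a p₀ ∈ Ω b := h.mem_of_injOn hcd hinj ⟨hca.trans hab, hbd⟩ ⟨hca, hab⟩ p₀
  apply Subset.antisymm
  · intro x hx
    by_contra hxW
    obtain ⟨z, hz, hzf⟩ := hDb.isConnected.isPreconnected.exists_mem_frontier hmeet (hbot p₀) hx hxW
    have := hDb.frontier_eq ▸ hWfr hzf
    exact (hDb.isOpen.frontier_eq ▸ this : z ∈ closure (Ω b) \ Ω b).2 hz
  · intro x hx
    by_contra hxb
    obtain ⟨z, hz, hzf⟩ := hWc.exists_mem_frontier (hbot p₀) hmeet hx hxb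
    rw [hDb.frontier_eq] at hzf
    obtain ⟨p, rfl⟩ := hzf
    exact hWdisj p hz

/-- The domain at time `b` consists of the domain at time `a` and of the region swept out between
the times `a` and `b`. -/
lemma domain_eq (h : IsExpandingFoliation I φ ν Ω) [CompactSpace M] [Nonempty M]
    (ha : a ∈ I) (hb : b ∈ I) (hab : a ≤ b) :
    Ω b = Ω a ∪ (fun q : ℝ × M => φ q.1 q.2) '' (Ico a b ×ˢ univ) := by
  have hsub : Icc a b ⊆ I := h.ordConnected.out ha hb
  have hloc : ∀ i : Icc a b, ∃ ε > 0, Ioo (i.1 - ε) (i.1 + ε) ⊆ I ∧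
      InjOn (fun q : ℝ × M => φ q.1 q.2) (Ioo (i.1 - ε) (i.1 + ε) ×ˢ univ) := fun i => by
    obtain ⟨ε, hε, hinj⟩ := h.exists_injOn (hsub i.2)
    obtain ⟨δ, hδ, hball⟩ := Metric.isOpen_iff.1 h.isOpen_time i.1 (hsub i.2)
    rw [Real.ball_eq_Ioo] at hball
    refine ⟨min ε δ, lt_min hε hδ, (Ioo_subset_Ioo ?_ ?_).trans hball,
      hinj.mono (prod_mono_left (Ioo_subset_Ioo ?_ ?_))⟩ <;>
    linarith [min_le_left ε δ, min_le_right ε δ]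
  choose ε hε hεI hεinj using hloc
  obtain ⟨t, ht0, htm, ⟨m, hm⟩, htc⟩ := exists_monotone_Icc_subset_open_cover_Icc hab
    (c := fun i : Icc a b => {s : Icc a b | s.1 ∈ Ioo (i.1 - ε i) (i.1 + ε i)})
    (fun i => isOpen_Ioo.preimage continuous_subtype_val)
    (fun s _ => mem_iUnion.2 ⟨s, by simp [hε s]⟩)
  have hstep : ∀ k, Ω (t k) = Ω a ∪ (fun q : ℝ × M => φ q.1 q.2) '' (Ico a (t k) ×ˢ univ) := by
    intro k
    induction k with
    | zero => simp [ht0]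
    | succ k ih =>
      have hle : (t k : ℝ) ≤ t (k + 1) := htm (Nat.le_succ k)
      rcases hle.lt_or_eq with hlt | heq
      · obtain ⟨i, hi⟩ := htc k
        have h1 := hi ⟨le_rfl, htm (Nat.le_succ k)⟩
        have h2 := hi ⟨htm (Nat.le_succ k), le_rfl⟩
        rw [h.domain_eq_of_injOn (hεI i) (hεinj i) h1.1 hlt h2.2, ih, union_assoc, ← image_union,
          ← union_prod, Ico_union_Ico_eq_Ico (t k).2.1 hle]
      · rw [← heq]; exact ih
  simpa [hm m le_rfl] using hstep m

variable [CompactSpace M] [Nonempty M]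

lemma domain_mono (h : IsExpandingFoliation I φ ν Ω) (ha : a ∈ I) (hb : b ∈ I) (hab : a ≤ b) :
    Ω a ⊆ Ω b := by
  rw [h.domain_eq ha hb hab]; exact subset_union_left

lemma mem_domain_iff (h : IsExpandingFoliation I φ ν Ω) (ha : a ∈ I) (hb : b ∈ I) (p : M) :
    φ a p ∈ Ω b ↔ a < b := by
  have hself : φ a p ∉ Ω a := fun hx => by
    have : φ a p ∈ frontier (Ω a) := (h.domain a ha).frontier_eq ▸ mem_range_self p
    rw [(h.domain a ha).isOpen.frontier_eq] at this
    exact this.2 hx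
  refine ⟨fun hx => lt_of_not_ge fun hba => hself (h.domain_mono hb ha hba hx), fun hab => ?_⟩
  rw [h.domain_eq ha hb hab.le]
  exact Or.inr ⟨(a, p), ⟨⟨le_rfl, hab⟩, trivial⟩, rfl⟩

lemma exists_eq_of_mem_closure (h : IsExpandingFoliation I φ ν Ω) (ha : a ∈ I) (hb : b ∈ I)
    (hab : a ≤ b) {x : EuclideanSpace ℝ (Fin (n + 1))} (hxb : x ∈ closure (Ω b)) (hxa : x ∉ Ω a) :
    ∃ t ∈ Icc a b, ∃ p, φ t p = x := by
  rw [closure_eq_self_union_frontier, (h.domain b hb).frontier_eq, h.domain_eq ha hb hab] at hxb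
  rcases hxb with (hx | ⟨⟨t, p⟩, ⟨ht, -⟩, rfl⟩) | ⟨p, rfl⟩
  · exact absurd hx hxa
  · exact ⟨t, Ico_subset_Icc_self ht, p, rfl⟩
  · exact ⟨b, ⟨hab, le_rfl⟩, p, rfl⟩

lemma time_eq (h : IsExpandingFoliation I φ ν Ω) (ha : a ∈ I) (hb : b ∈ I) {p q : M}
    (hpq : φ a p = φ b q) : a = b := by
  apply le_antisymm
  · refine le_of_not_gt fun hlt => lt_irrefl a ?_
    rw [← h.mem_domain_iff ha ha p, hpq]
    exact (h.mem_domain_iff hb ha q).2 hlt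
  · refine le_of_not_gt fun hlt => lt_irrefl b ?_
    rw [← h.mem_domain_iff hb hb q, ← hpq]
    exact (h.mem_domain_iff ha hb p).2 hlt

end Step

end IsExpandingFoliation

/-! ### The arrival time -/

open scoped Classical in
/-- The arrival time of the hypersurfaces `φ t (M)` at the point `x`, with junk value `0` at the
points that are never reached. -/
noncomputable def arrivalTime {M E : Type*} (I : Set ℝ) (φ : ℝ → M → E) (x : E) : ℝ :=
  if h : ∃ q : ℝ × M, q.1 ∈ I ∧ φ q.1 q.2 = x then h.choose.1 else 0

open scoped Classical in
/-- The arrival time cut off to `[a, b]`: it is `a` in the domain `Ω a` and `b` outside `Ω b`. -/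
noncomputable def clampedTime {M E : Type*} (I : Set ℝ) (φ : ℝ → M → E) (Ω : ℝ → Set E) (a b : ℝ)
    (x : E) : ℝ :=
  if x ∈ Ω a then a else if x ∈ Ω b then arrivalTime I φ x else b

namespace IsExpandingFoliation

variable {n : ℕ} {M : Type*} [TopologicalSpace M] {I : Set ℝ}
  {φ ν : ℝ → M → EuclideanSpace ℝ (Fin (n + 1))}
  {Ω : ℝ → Set (EuclideanSpace ℝ (Fin (n + 1)))}
  {a b t : ℝ}

lemma clampedTime_eventuallyEq_left (h : IsExpandingFoliation I φ ν Ω) (ha : a ∈ I)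
    {x : EuclideanSpace ℝ (Fin (n + 1))} (hx : x ∈ Ω a) :
    clampedTime I φ Ω a b =ᶠ[𝓝 x] fun _ => a := by
  filter_upwards [(h.domain a ha).isOpen.mem_nhds hx] with y hy
  rw [clampedTime, if_pos hy]

variable [LocallyConnectedSpace M] [CompactSpace M] [Nonempty M]

lemma arrivalTime_apply (h : IsExpandingFoliation I φ ν Ω) (ht : t ∈ I) (p : M) :
    arrivalTime I φ (φ t p) = t := by
  have hex : ∃ q : ℝ × M, q.1 ∈ I ∧ φ q.1 q.2 = φ t p := ⟨(t, p), ht, rfl⟩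
  rw [arrivalTime, dif_pos hex]
  exact h.time_eq hex.choose_spec.1 ht hex.choose_spec.2

lemma contDiffAt_arrivalTime (h : IsExpandingFoliation I φ ν Ω) (ht : t ∈ I) (p : M) :
    ContDiffAt ℝ ∞ (arrivalTime I φ) (φ t p) := by
  obtain ⟨e, hmem, he, hsm, -⟩ := h.box t ht p
  refine hsm.congr_of_eventuallyEq ?_
  have hx : φ t p ∈ e.target := (he _ hmem).2 ▸ e.map_source hmem
  filter_upwards [e.open_target.mem_nhds hx] with y hy
  have h1 := he _ (e.map_target hy)
  rw [e.right_inv hy] at h1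
  conv_lhs => rw [h1.2]
  exact h.arrivalTime_apply h1.1 _

lemma clampedTime_apply (h : IsExpandingFoliation I φ ν Ω) (ha : a ∈ I) (hb : b ∈ I) (hab : a ≤ b)
    (ht : t ∈ I) (p : M) : clampedTime I φ Ω a b (φ t p) = max a (min t b) := by
  rw [clampedTime, h.mem_domain_iff ht ha, h.mem_domain_iff ht hb, h.arrivalTime_apply ht]
  split_ifs with h1 h2
  · rw [max_eq_left ((min_le_left _ _).trans h1.le)]
  · rw [min_eq_left h2.le, max_eq_right (not_lt.1 h1)]
  · rw [min_eq_right (not_lt.1 h2), max_eq_right hab]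

lemma clampedTime_eventuallyEq_right (h : IsExpandingFoliation I φ ν Ω) (ha : a ∈ I) (hb : b ∈ I)
    (hab : a ≤ b) {x : EuclideanSpace ℝ (Fin (n + 1))} (hx : x ∉ closure (Ω b)) :
    clampedTime I φ Ω a b =ᶠ[𝓝 x] fun _ => b := by
  filter_upwards [isClosed_closure.isOpen_compl.mem_nhds hx] with y hy
  have hyb : y ∉ Ω b := fun hh => hy (subset_closure hh)
  rw [clampedTime, if_neg fun hh => hyb (h.domain_mono ha hb hab hh), if_neg hyb]

lemma clampedTime_eventuallyEq_arrivalTime (h : IsExpandingFoliation I φ ν Ω) (ha : a ∈ I)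
    (hb : b ∈ I) (hab : a ≤ b) (ht : t ∈ I) (p : M) :
    clampedTime I φ Ω a b =ᶠ[𝓝 (φ t p)] fun x => max a (min (arrivalTime I φ x) b) := by
  filter_upwards [h.image_mem_nhds ht p ((h.isOpen_time.prod isOpen_univ).mem_nhds
    ⟨ht, mem_univ p⟩)]
  rintro _ ⟨⟨s, q⟩, ⟨hs, -⟩, rfl⟩
  dsimp only at hs ⊢
  rw [h.clampedTime_apply ha hb hab hs, h.arrivalTime_apply hs]

lemma continuous_clampedTime (h : IsExpandingFoliation I φ ν Ω) (ha : a ∈ I) (hb : b ∈ I)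
    (hab : a ≤ b) : Continuous (clampedTime I φ Ω a b) := by
  rw [continuous_iff_continuousAt]
  intro x
  by_cases hxa : x ∈ Ω a
  · exact continuousAt_const.congr (h.clampedTime_eventuallyEq_left ha hxa).symm
  by_cases hxb : x ∈ closure (Ω b)
  · obtain ⟨t, ht, p, rfl⟩ := h.exists_eq_of_mem_closure ha hb hab hxb hxa
    have htI := h.ordConnected.out ha hb ht
    have hcont : ContinuousAt (fun x => max a (min (arrivalTime I φ x) b)) (φ t p) :=
      continuousAt_const.max
        ((h.contDiffAt_arrivalTime htI p).continuousAt.min continuousAt_const)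
    exact hcont.congr
      (h.clampedTime_eventuallyEq_arrivalTime ha hb hab htI p).symm
  · exact continuousAt_const.congr (h.clampedTime_eventuallyEq_right ha hb hab hxb).symm

end IsExpandingFoliation

/-! ### The level set equation -/

section LevelSet

variable {V : Type*} [NormedAddCommGroup V] [InnerProductSpace ℝ V]

/-- At the point `x`, the function `u` satisfies the level set equation `|∇u| = F(κ)`, where `κ`
are the principal curvatures of the level set of `u` with respect to the normal `∇u / |∇u|`:
the gradient of `u` is `F(κ) N` with `N` a unit vector, and in an orthonormal basis `e` of `Nᗮ`
the Hessian of `u` is diagonal with entries `F(κ) κᵢ`. -/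
def IsLevelSetSolutionAt {n : ℕ} (Γ : Set (Fin n → ℝ)) (F : (Fin n → ℝ) → ℝ) (u : V → ℝ) (x : V) :
    Prop :=
  ∃ κ ∈ Γ, ∃ (N : V) (e : Fin n → V), ‖N‖ = 1 ∧ Orthonormal ℝ e ∧ (∀ i, inner ℝ N (e i) = 0) ∧
    (∀ v, fderiv ℝ u x v = F κ * inner ℝ N v) ∧
    ∀ i j, fderiv ℝ (fderiv ℝ u) x (e i) (e j) = if i = j then F κ * κ i else 0

lemma IsLevelSetSolutionAt.fderiv_ne_zero {n : ℕ} {Γ : Set (Fin n → ℝ)} {F : (Fin n → ℝ) → ℝ}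
    (hF : IsAdmissibleSpeed Γ F) {u : V → ℝ} {x : V} (h : IsLevelSetSolutionAt Γ F u x) :
    fderiv ℝ u x ≠ 0 := by
  obtain ⟨κ, hκ, N, e, hN, -, -, hdu, -⟩ := h
  intro h0
  have := hdu N
  rw [h0, real_inner_self_eq_norm_sq, hN] at this
  exact (hF.pos κ hκ).ne (by simpa using this)

lemma hasDerivAt_comp_line {u : V → ℝ} {x : V} (hu : ContDiffAt ℝ 2 u x) (v : V) :
    (∀ᶠ s in 𝓝 (0 : ℝ), HasDerivAt (fun s : ℝ => u (x + s • v)) (fderiv ℝ u (x + s • v) v) s) ∧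
    HasDerivAt (fun s : ℝ => fderiv ℝ u (x + s • v) v) (fderiv ℝ (fderiv ℝ u) x v v) 0 := by
  have hline : ∀ s : ℝ, HasDerivAt (fun s : ℝ => x + s • v) v s := fun s => by
    simpa using ((hasDerivAt_id s).smul_const v).const_add x
  constructor
  · have h1 : ∀ᶠ y in 𝓝 x, DifferentiableAt ℝ u y :=
      (hu.eventually (by simp)).mono fun y hy => hy.differentiableAt (by simp)
    have h2 : Tendsto (fun s : ℝ => x + s • v) (𝓝 0) (𝓝 x) := by
      simpa using (hline 0).continuousAt.tendsto
    filter_upwards [h2.eventually h1] with s hs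
    exact hs.hasFDerivAt.comp_hasDerivAt s (hline s)
  · have h1 : DifferentiableAt ℝ (fderiv ℝ u) x :=
      (hu.fderiv_right (m := 1) (by norm_num)).differentiableAt (by simp)
    have h2 : HasFDerivAt (fderiv ℝ u) (fderiv ℝ (fderiv ℝ u) x) (x + (0 : ℝ) • v) := by
      simpa using h1.hasFDerivAt
    have h3 : HasDerivAt (fun s : ℝ => fderiv ℝ u (x + s • v)) (fderiv ℝ (fderiv ℝ u) x v) 0 :=
      h2.comp_hasDerivAt (0 : ℝ) (hline 0)
    exact (ContinuousLinearMap.apply ℝ ℝ v).hasFDerivAt.comp_hasDerivAt (0 : ℝ) h3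

/-- A bilinear form that is diagonal in the basis `e` of `Nᗮ`, evaluated on the diagonal; applied
to the Hessian of a solution of the level set equation and tangent vectors of the level set. -/
lemma hessian_eq_sum {n : ℕ} (hV : Module.finrank ℝ V = n + 1) {N : V} {e : Fin n → V}
    (hN : ‖N‖ = 1) (he : Orthonormal ℝ e) (hNe : ∀ i, inner ℝ N (e i) = 0)
    {B : V →L[ℝ] V →L[ℝ] ℝ} {c : ℝ} {κ : Fin n → ℝ}
    (hB : ∀ i j, B (e i) (e j) = if i = j then c * κ i else 0) {v : V} (hv : inner ℝ N v = 0) :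
    B v v = c * ∑ i, κ i * inner ℝ (e i) v ^ 2 := by
  have hexp : v = ∑ i, inner ℝ (e i) v • e i := by
    simpa [hv] using eq_inner_smul_add_sum hV hN he hNe v
  calc B v v = B (∑ i, inner ℝ (e i) v • e i) (∑ i, inner ℝ (e i) v • e i) := by rw [← hexp]
    _ = c * ∑ i, κ i * inner ℝ (e i) v ^ 2 := by
      simp only [map_sum, map_smul, sum_apply, smul_apply,
        hB, smul_eq_mul, Finset.mul_sum]
      refine Finset.sum_congr rfl fun i _ => ?_
      simp
      ring

/-- A solution `u` of the level set equation, moved by an isometry and slowed down by a time change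
`θ` with `θ' < 1`, cannot touch `u` from below up to a constant: at a touching point the gradient of the
slowed down solution would be that of `u`, hence its own gradient before slowing down would be
strictly longer, while the comparison of Hessians along the common tangent hyperplane gives the
opposite inequality between the speeds. -/
lemma not_isLocalMax_slowed_sub {n : ℕ} {Γ : Set (Fin n → ℝ)} {F : (Fin n → ℝ) → ℝ}
    (hF : IsAdmissibleSpeed Γ F) [FiniteDimensional ℝ V] (hV : Module.finrank ℝ V = n + 1)
    {u : V → ℝ} {x : V} (R : V ≃ᵃⁱ[ℝ] V) (hux : ContDiffAt ℝ 2 u x)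
    (huR : ContDiffAt ℝ 2 u (R x)) (hx : IsLevelSetSolutionAt Γ F u x)
    (hRx : IsLevelSetSolutionAt Γ F u (R x)) {θ θ' : ℝ → ℝ} (hθ : ∀ t, HasDerivAt θ (θ' t) t)
    (hθd : Differentiable ℝ θ') (hθ' : ∀ t, 0 ≤ θ' t ∧ θ' t < 1) :
    ¬ IsLocalMax (fun z => θ (u (R z)) - u z) x := by
  intro hmax
  obtain ⟨κ, hκ, N, e, hN, he, hNe, hdu, hd2u⟩ := hx
  obtain ⟨μ, hμ, N', e', hN', he', hNe', hdu', hd2u'⟩ := hRx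
  set L := R.linearIsometryEquiv with hL
  have hRline : ∀ (v : V) (s : ℝ), R (x + s • v) = R x + s • L v := fun v s => by
    have := R.map_vadd x (s • v)
    simp only [vadd_eq_add] at this
    rw [add_comm, this, map_smul, add_comm]
  have hinner : ∀ v w, inner ℝ (L.symm w) v = inner ℝ w (L v) := fun v w => by
    rw [← L.inner_map_map, L.apply_symm_apply]
  have hFκ := hF.pos κ hκ
  have hFμ := hF.pos μ hμ
  have hlmax : ∀ v, IsLocalMax (fun s : ℝ => θ (u (R x + s • L v)) - u (x + s • v)) 0 := fun v => by
    have h1 : Tendsto (fun s : ℝ => x + s • v) (𝓝 0) (𝓝 x) := by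
      have : ContinuousAt (fun s : ℝ => x + s • v) 0 := by fun_prop
      simpa using this.tendsto
    filter_upwards [h1.eventually hmax] with s hs
    rw [hRline] at hs
    simpa using hs
  -- first order: the gradients at the touching point agree up to the isometry
  have hfirst : ∀ v, θ' (u (R x)) * F μ * inner ℝ (L.symm N') v = F κ * inner ℝ N v := fun v => by
    have h1 := (hasDerivAt_comp_line hux v).1.self_of_nhds
    have h2 := (hasDerivAt_comp_line huR (L v)).1.self_of_nhds
    have h3 := ((hθ _).comp (0 : ℝ) h2).sub h1
    have h4 := (hlmax v).hasDerivAt_eq_zero h3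
    simp only [zero_smul, add_zero, hdu, hdu'] at h4
    rw [hinner]
    linarith
  have hvec : (θ' (u (R x)) * F μ) • L.symm N' = F κ • N := by
    refine ext_inner_right ℝ fun v => ?_
    rw [inner_smul_left, inner_smul_left]
    exact hfirst v
  have hspeed : θ' (u (R x)) * F μ = F κ := by
    have := congrArg norm hvec
    rw [norm_smul, norm_smul, L.symm.norm_map, hN, hN', Real.norm_of_nonneg
      (mul_nonneg (hθ' _).1 hFμ.le), Real.norm_of_nonneg hFκ.le] at this
    linarith
  have hNN : L.symm N' = N := by
    rw [hspeed] at hvec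
    exact smul_right_injective V hFκ.ne' hvec
  have hlt : F κ < F μ := by
    rw [← hspeed]
    nlinarith [(hθ' (u (R x))).2]
  -- second order: compare the Hessians on the tangent hyperplane
  refine absurd (hF.le_of_forall_sum_le hV hN he (f := fun i => L.symm (e' i)) ?_ hNe ?_ hκ hμ ?_)
    (not_le.2 hlt)
  · exact he'.comp_linearIsometryEquiv L.symm
  · intro i
    rw [← hNN, L.symm.inner_map_map, hNe']
  · intro v hv
    have hv' : inner ℝ N' (L v) = 0 := by rw [← hinner, hNN, hv]
    obtain ⟨h1, h1'⟩ := hasDerivAt_comp_line hux v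
    obtain ⟨h2, h2'⟩ := hasDerivAt_comp_line huR (L v)
    have h3 := mul_le_of_isLocalMax_comp_sub hθ hθd h1 h1' h2 h2'
      (by simp [hdu', hv']) (hlmax v)
    rw [hessian_eq_sum hV hN he hNe hd2u hv, hessian_eq_sum hV hN' he' hNe' hd2u' hv', zero_smul,
      add_zero, ← mul_assoc, hspeed] at h3
    simp only [hinner]
    exact le_of_mul_le_mul_left h3 hFκ

end LevelSet

/-! ### Comparison with the image under an isometry -/

namespace IsExpandingFoliation

variable {n : ℕ} {M : Type*} [TopologicalSpace M] {I : Set ℝ}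
  {φ ν : ℝ → M → EuclideanSpace ℝ (Fin (n + 1))}
  {Ω : ℝ → Set (EuclideanSpace ℝ (Fin (n + 1)))}
  [LocallyConnectedSpace M] [CompactSpace M] [Nonempty M] {a b t : ℝ}

lemma clampedTime_mem_Icc (h : IsExpandingFoliation I φ ν Ω) (ha : a ∈ I) (hb : b ∈ I)
    (hab : a ≤ b) (x : EuclideanSpace ℝ (Fin (n + 1))) : clampedTime I φ Ω a b x ∈ Icc a b := by
  by_cases hxa : x ∈ Ω a
  · simp [clampedTime, hxa, hab]
  by_cases hxb : x ∈ Ω b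
  · obtain ⟨t, ht, p, rfl⟩ := h.exists_eq_of_mem_closure ha hb hab (subset_closure hxb) hxa
    rw [h.clampedTime_apply ha hb hab (h.ordConnected.out ha hb ht)]
    exact ⟨le_max_left _ _, max_le hab (min_le_right _ _)⟩
  · simp [clampedTime, hxa, hxb, hab]

/-- Comparison of the flow with its image under an isometry `R`, on a closed region `H` with
boundary fixed by `R`: if `H` does not meet the flow at time `a`, then from time `a` on, `R` maps
`Ω t ∩ H` into `Ω t`. For reflections this is the Alexandrov reflection principle. -/
lemma map_mem_of_disjoint (h : IsExpandingFoliation I φ ν Ω) {Γ : Set (Fin n → ℝ)}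
    {F : (Fin n → ℝ) → ℝ} (hF : IsAdmissibleSpeed Γ F)
    (hlevel : ∀ t ∈ I, ∀ p, IsLevelSetSolutionAt Γ F (arrivalTime I φ) (φ t p))
    (R : EuclideanSpace ℝ (Fin (n + 1)) ≃ᵃⁱ[ℝ] EuclideanSpace ℝ (Fin (n + 1)))
    {H : Set (EuclideanSpace ℝ (Fin (n + 1)))} (hH : IsClosed H)
    (hfix : ∀ x ∈ H, x ∉ interior H → R x = x) (ha : a ∈ I) (hdisj : ∀ x ∈ H, x ∉ closure (Ω a))
    (ht : t ∈ I) (hat : a ≤ t) {x : EuclideanSpace ℝ (Fin (n + 1))} (hxH : x ∈ H)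
    (hxt : x ∈ Ω t) : R x ∈ Ω t := by
  by_contra hRx
  obtain ⟨τ, hτ, p, rfl⟩ := h.exists_eq_of_mem_closure ha ht hat (subset_closure hxt)
    (fun hx => hdisj x hxH (subset_closure hx))
  have hτI := h.ordConnected.out ha ht hτ
  have hτt : τ < t := (h.mem_domain_iff hτI ht p).1 hxt
  obtain ⟨b, htb, hb⟩ : ∃ b, t < b ∧ b ∈ I := by
    have h1 : ∀ᶠ b in 𝓝[>] t, b ∈ I := mem_nhdsWithin_of_mem_nhds (h.isOpen_time.mem_nhds ht)
    obtain ⟨b, hb, htb⟩ := (h1.and self_mem_nhdsWithin).exists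
    exact ⟨b, htb, hb⟩
  have hab : a ≤ b := hat.trans htb.le
  obtain ⟨θ, θ', hθ, hθd, hθ', hθa, hθle, hθb, hτθ⟩ := exists_slow_time_change hτ.1 hτt htb
  have hθmono : Monotone θ := monotone_of_hasDerivAt_nonneg hθ fun t => (hθ' t).1
  set T := clampedTime I φ Ω a b with hT
  have hTmem := h.clampedTime_mem_Icc ha hb hab
  have hTc := h.continuous_clampedTime ha hb hab
  let G : EuclideanSpace ℝ (Fin (n + 1)) → ℝ := fun z => θ (T (R z)) - T z
  have hGc : Continuous G := by
    have hθc : Continuous θ := continuous_iff_continuousAt.2 fun t => (hθ t).continuousAt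
    exact (hθc.comp (hTc.comp R.continuous)).sub hTc
  have hG0 : 0 < G (φ τ p) := by
    have h1 : T (φ τ p) = τ := by
      rw [hT, h.clampedTime_apply ha hb hab hτI, min_eq_left (hτt.trans htb).le,
        max_eq_right hτ.1]
    have h2 : t ≤ T (R (φ τ p)) := by
      by_cases hRb : R (φ τ p) ∈ Ω b
      · obtain ⟨s, hs, q, hq⟩ := h.exists_eq_of_mem_closure ht hb htb.le (subset_closure hRb) hRx
        rw [← hq, hT, h.clampedTime_apply ha hb hab (h.ordConnected.out ht hb hs)]
        exact le_max_of_le_right (le_min hs.1 htb.le)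
      · rw [hT, clampedTime, if_neg fun hh => hRx (h.domain_mono ha ht hat hh), if_neg hRb]
        exact htb.le
    have := hθmono h2
    simp only [G, h1]
    linarith
  have hK : IsCompact (H ∩ closure (Ω b)) :=
    (h.domain b hb).isBounded.isCompact_closure.inter_left hH
  obtain ⟨z, ⟨hzH, hzb⟩, hzmax⟩ := hK.exists_isMaxOn
    ⟨φ τ p, hxH, subset_closure (h.domain_mono ht hb htb.le hxt)⟩ hGc.continuousOn
  have hGz : 0 < G z := hG0.trans_le
    (hzmax ⟨hxH, subset_closure (h.domain_mono ht hb htb.le hxt)⟩)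
  obtain ⟨s, hs, q, rfl⟩ := h.exists_eq_of_mem_closure ha hb hab hzb
    (fun hx => hdisj z hzH (subset_closure hx))
  have hsI := h.ordConnected.out ha hb hs
  have hTz : T (φ s q) = s := by
    rw [hT, h.clampedTime_apply ha hb hab hsI, min_eq_left hs.2, max_eq_right hs.1]
  simp only [G, hTz] at hGz
  -- the maximum lies strictly between the times `a` and `b`, and in the interior of `H`
  have hsb : s < b := by
    have := hθle _ (hTmem (R (φ s q))).1
    linarith [(hTmem (R (φ s q))).2]
  have has : a < s := hs.1.lt_of_ne fun has => hdisj _ hzH (by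
    rw [has]
    exact frontier_subset_closure ((h.domain s hsI).frontier_eq ▸ mem_range_self q))
  have hzint : φ s q ∈ interior H := by
    by_contra hzi
    rw [hfix _ hzH hzi, hTz] at hGz
    linarith [hθle s hs.1]
  have hlmax : IsLocalMax G (φ s q) := by
    filter_upwards [isOpen_interior.mem_nhds hzint,
      (h.domain b hb).isOpen.mem_nhds ((h.mem_domain_iff hsI hb q).2 hsb)] with y hy1 hy2
    exact hzmax ⟨interior_subset hy1, subset_closure hy2⟩
  have hTu : T =ᶠ[𝓝 (φ s q)] arrivalTime I φ := by
    have hc := (h.contDiffAt_arrivalTime hsI q).continuousAt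
    have h1 : ∀ᶠ y in 𝓝 (φ s q), arrivalTime I φ y ∈ Ioo a b :=
      hc.eventually (by
        rw [h.arrivalTime_apply hsI]
        exact Ioo_mem_nhds has hsb)
    filter_upwards [h1, h.clampedTime_eventuallyEq_arrivalTime ha hb hab hsI q] with y hy1 hy2
    rw [hT, hy2, min_eq_left hy1.2.le, max_eq_right hy1.1.le]
  have hRc : Tendsto R (𝓝 (φ s q)) (𝓝 (R (φ s q))) := R.continuous.tendsto _
  by_cases hRb : R (φ s q) ∈ closure (Ω b)
  · have hRa : R (φ s q) ∉ Ω a := fun hRa => by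
      have h1 : T (R (φ s q)) = a := by rw [hT, clampedTime, if_pos hRa]
      rw [h1, hθa] at hGz
      linarith
    obtain ⟨r, hr, q', hq'⟩ := h.exists_eq_of_mem_closure ha hb hab hRb hRa
    have hrI := h.ordConnected.out ha hb hr
    have har : a < r := hr.1.lt_of_ne fun har => by
      rw [← hq', hT, h.clampedTime_apply ha hb hab hrI, min_eq_left hr.2, max_eq_right hr.1, ← har,
        hθa] at hGz
      linarith
    -- `θ` is constant beyond `b`, so the clamping of the arrival time at `b` is not seen
    have hθu : ∀ᶠ y in 𝓝 (R (φ s q)), θ (T y) = θ (arrivalTime I φ y) := by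
      rw [← hq']
      have hc := (h.contDiffAt_arrivalTime hrI q').continuousAt
      have h1 : ∀ᶠ y in 𝓝 (φ r q'), arrivalTime I φ y ∈ Ioi a :=
        hc.eventually (by
          rw [h.arrivalTime_apply hrI]
          exact Ioi_mem_nhds har)
      filter_upwards [h1, h.clampedTime_eventuallyEq_arrivalTime ha hb hab hrI q'] with y hy1 hy2
      rw [hT, hy2]
      rcases le_total (arrivalTime I φ y) b with hyb | hyb
      · rw [min_eq_left hyb, max_eq_right (le_of_lt hy1)]
      · rw [min_eq_right hyb, max_eq_right hab, hθb _ hyb]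
    refine not_isLocalMax_slowed_sub hF (by simp) R
      (contDiffAt_infty.1 (h.contDiffAt_arrivalTime hsI q) 2) ?_ (hlevel s hsI q) ?_
      hθ hθd hθ' (hlmax.congr ?_)
    · rw [← hq']
      exact contDiffAt_infty.1 (h.contDiffAt_arrivalTime hrI q') 2
    · rw [← hq']
      exact hlevel r hrI q'
    · filter_upwards [hTu, hRc.eventually hθu] with y hy1 hy2
      simp only [G, hy1, hy2]
  · have hconst : ∀ᶠ y in 𝓝 (φ s q), G y = θ b - arrivalTime I φ y := by
      filter_upwards [hTu, hRc.eventually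
        (h.clampedTime_eventuallyEq_right ha hb hab hRb)] with y hy1 hy2
      rw [← hT] at hy2
      simp only [G, hy1, hy2]
    have hmin : IsLocalMin (arrivalTime I φ) (φ s q) := by
      filter_upwards [hlmax, hconst] with y hy1 hy2
      rw [hy2, hconst.self_of_nhds] at hy1
      linarith
    exact (hlevel s hsI q).fderiv_ne_zero hF hmin.fderiv_eq_zero

end IsExpandingFoliation

/-! ### From the flow to the level set equation -/

lemma isOpen_timeInterval (T₀ T₁ : EReal) : IsOpen (timeInterval T₀ T₁) :=
  (isOpen_Ioo (a := T₀) (b := T₁)).preimage continuous_coe_real_ereal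

lemma ordConnected_timeInterval (T₀ T₁ : EReal) : (timeInterval T₀ T₁).OrdConnected :=
  ⟨fun _ ha _ hb _ hx => ⟨ha.1.trans_le (EReal.coe_le_coe_iff.2 hx.1),
    (EReal.coe_le_coe_iff.2 hx.2).trans_lt hb.2⟩⟩

section Curves

variable {n : ℕ} {M : Type*} [TopologicalSpace M] [ChartedSpace (EuclideanSpace ℝ (Fin n)) M]

/-- The curve through `p` with initial velocity `w` which is a straight line in the chart at `p`. -/
noncomputable def chartLine (p : M) (w : EuclideanSpace ℝ (Fin n)) (s : ℝ) : M :=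
  (chartAt (EuclideanSpace ℝ (Fin n)) p).symm (chartAt (EuclideanSpace ℝ (Fin n)) p p + s • w)

lemma chartLine_zero (p : M) (w : EuclideanSpace ℝ (Fin n)) : chartLine p w 0 = p := by
  simp [chartLine]

lemma continuousAt_chartLine (p : M) (w : EuclideanSpace ℝ (Fin n)) :
    ContinuousAt (chartLine p w) 0 := by
  have h1 : ContinuousAt (chartAt (EuclideanSpace ℝ (Fin n)) p).symm
      (chartAt (EuclideanSpace ℝ (Fin n)) p p + (0 : ℝ) • w) := by
    simpa using (chartAt (EuclideanSpace ℝ (Fin n)) p).continuousAt_symm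
      (mem_chart_target (EuclideanSpace ℝ (Fin n)) p)
  exact ContinuousAt.comp (f := fun s : ℝ => chartAt (EuclideanSpace ℝ (Fin n)) p p + s • w) h1
    (by fun_prop)

lemma hasDerivAt_comp_chartLine {f : M → EuclideanSpace ℝ (Fin (n + 1))} {p : M}
    (hf : MDifferentiableAt (𝓡 n) (𝓡 (n + 1)) f p) (w : EuclideanSpace ℝ (Fin n)) :
    HasDerivAt (fun s => f (chartLine p w s)) (ambientDifferential f p w) 0 := by
  have h1 : HasFDerivAt (fun z => f ((chartAt (EuclideanSpace ℝ (Fin n)) p).symm z))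
      (show EuclideanSpace ℝ (Fin n) →L[ℝ] EuclideanSpace ℝ (Fin (n + 1)) from
        ambientDifferential f p) (chartAt (EuclideanSpace ℝ (Fin n)) p p) :=
    HasFDerivWithinAt.hasFDerivAt (s := range (𝓡 n)) hf.hasMFDerivAt.2 (by simp)
  have h2 : HasDerivAt (fun s : ℝ => chartAt (EuclideanSpace ℝ (Fin n)) p p + s • w) w 0 := by
    simpa using ((hasDerivAt_id (0 : ℝ)).smul_const w).const_add
      (chartAt (EuclideanSpace ℝ (Fin n)) p p)
  exact HasFDerivAt.comp_hasDerivAt_of_eq (0 : ℝ) h1 h2 (by simp)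

/-- Principal directions as velocities of curves: this form avoids the tangent bundle. -/
lemma IsPrincipalCurvatures.exists_frame {f N : M → EuclideanSpace ℝ (Fin (n + 1))} {p : M}
    {κ : Fin n → ℝ} (h : IsPrincipalCurvatures f N p κ)
    (hf : MDifferentiableAt (𝓡 n) (𝓡 (n + 1)) f p) (hN : IsOuterUnitNormal f N) :
    ∃ (E : Fin n → EuclideanSpace ℝ (Fin (n + 1))) (w : Fin n → EuclideanSpace ℝ (Fin n)),
      Orthonormal ℝ E ∧ (∀ i, inner ℝ (N p) (E i) = 0) ∧
      (∀ i, HasDerivAt (fun s => f (chartLine p (w i) s)) (E i) 0) ∧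
      ∀ i, HasDerivAt (fun s => N (chartLine p (w i) s)) (κ i • E i) 0 := by
  obtain ⟨hNd, e, he, hκ⟩ := h
  exact ⟨fun i => ambientDifferential f p (e i), e, he, fun i => hN.2.1 p (e i),
    fun i => hasDerivAt_comp_chartLine hf (e i),
    fun i => (hasDerivAt_comp_chartLine hNd (e i)).congr_deriv (hκ i)⟩

end Curves

namespace IsExpandingFlow

variable {n : ℕ} {Γ : Set (Fin n → ℝ)} {F : (Fin n → ℝ) → ℝ} {M : Type*} [TopologicalSpace M]
  [ChartedSpace (EuclideanSpace ℝ (Fin n)) M] {T₀ T₁ : EReal}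
  {φ : ℝ → M → EuclideanSpace ℝ (Fin (n + 1))} {t : ℝ}

lemma contMDiffAt (hφ : IsExpandingFlow Γ F T₀ T₁ φ) (ht : t ∈ timeInterval T₀ T₁) (p : M) :
    ContMDiffAt (𝓘(ℝ, ℝ).prod (𝓡 n)) (𝓡 (n + 1)) ∞ (fun q : ℝ × M => φ q.1 q.2) (t, p) :=
  hφ.smooth.contMDiffAt (((isOpen_timeInterval T₀ T₁).prod isOpen_univ).mem_nhds
    ⟨ht, mem_univ p⟩)

lemma mdifferentiableAt (hφ : IsExpandingFlow Γ F T₀ T₁ φ) (ht : t ∈ timeInterval T₀ T₁) (p : M) :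
    MDifferentiableAt (𝓡 n) (𝓡 (n + 1)) (φ t) p := by
  have h1 : ContMDiffAt (𝓡 n) (𝓘(ℝ, ℝ).prod (𝓡 n)) ∞ (fun q : M => (t, q)) p :=
    contMDiffAt_const.prodMk contMDiffAt_id
  exact ((hφ.contMDiffAt ht p).comp p h1).mdifferentiableAt (by simp)

/-- A function whose level set at time `t` is `φ t (M)` has gradient `F(κ) ν`. -/
lemma fderiv_eq (hF : IsAdmissibleSpeed Γ F) (hφ : IsExpandingFlow Γ F T₀ T₁ φ)
    (ht : t ∈ timeInterval T₀ T₁) {ν : M → EuclideanSpace ℝ (Fin (n + 1))}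
    (hν : IsOuterUnitNormal (φ t) ν) {p : M} {κ : Fin n → ℝ}
    (hp : IsPrincipalCurvatures (φ t) ν p κ) (hκ : κ ∈ Γ)
    (hev : HasDerivAt (fun s : ℝ => φ s p) ((F κ)⁻¹ • ν p) t)
    {u : EuclideanSpace ℝ (Fin (n + 1)) → ℝ} (hu : DifferentiableAt ℝ u (φ t p))
    (hut : ∀ᶠ q in 𝓝 (t, p), u (φ q.1 q.2) = q.1) (v : EuclideanSpace ℝ (Fin (n + 1))) :
    fderiv ℝ u (φ t p) v = F κ * inner ℝ (ν p) v := by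
  obtain ⟨E, w, hE, hνE, hd, -⟩ := hp.exists_frame (hφ.mdifferentiableAt ht p) hν
  have hFκ := hF.pos κ hκ
  have h1 : fderiv ℝ u (φ t p) (ν p) = F κ := by
    have h2 := hu.hasFDerivAt.comp_hasDerivAt t hev
    have h3 : (u ∘ fun s => φ s p) =ᶠ[𝓝 t] id := by
      have hc : Tendsto (fun s : ℝ => (s, p)) (𝓝 t) (𝓝 (t, p)) :=
        (Continuous.prodMk_left p).tendsto t
      filter_upwards [hc.eventually hut] with s hs using hs
    have h4 := (h2.congr_of_eventuallyEq h3.symm).unique (hasDerivAt_id t)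
    rw [map_smul, smul_eq_mul, inv_mul_eq_iff_eq_mul₀ hFκ.ne', mul_one] at h4
    exact h4
  have h5 : ∀ i, fderiv ℝ u (φ t p) (E i) = 0 := fun i => by
    have h2 := HasFDerivAt.comp_hasDerivAt_of_eq (0 : ℝ) hu.hasFDerivAt (hd i)
      (by simp [chartLine_zero])
    have h3 : (u ∘ fun s => φ t (chartLine p (w i) s)) =ᶠ[𝓝 0] fun _ => t := by
      have hc : Tendsto (fun s : ℝ => (t, chartLine p (w i) s)) (𝓝 0) (𝓝 (t, p)) := by
        have := (continuousAt_const (y := t)).prodMk (continuousAt_chartLine p (w i))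
        simpa [ContinuousAt, chartLine_zero] using this
      filter_upwards [hc.eventually hut] with s hs using hs
    exact (h2.congr_of_eventuallyEq h3.symm).unique (hasDerivAt_const 0 t)
  have hv := eq_inner_smul_add_sum (by simp) (hν.1 p) hE hνE v
  conv_lhs => rw [hv]
  simp [h1, h5, mul_comm]

/-- A function whose level sets are the hypersurfaces `φ t (M)` solves the level set equation. -/
lemma isLevelSetSolutionAt (hF : IsAdmissibleSpeed Γ F) (hφ : IsExpandingFlow Γ F T₀ T₁ φ)
    (ht : t ∈ timeInterval T₀ T₁) {p : M} {u : EuclideanSpace ℝ (Fin (n + 1)) → ℝ}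
    (hu : ContDiffAt ℝ 2 u (φ t p)) (hut : ∀ᶠ q in 𝓝 (t, p), u (φ q.1 q.2) = q.1) :
    IsLevelSetSolutionAt Γ F u (φ t p) := by
  obtain ⟨ν, hν, hev⟩ := hφ.evolution t ht
  choose κ hκp hκΓ hκev using hev
  obtain ⟨E, w, hE, hνE, hdφ, hdν⟩ := (hκp p).exists_frame (hφ.mdifferentiableAt ht p) hν
  have hgrad := hφ.fderiv_eq hF ht hν (hκp p) (hκΓ p) (hκev p)
    (hu.differentiableAt (by simp)) hut
  refine ⟨κ p, hκΓ p, ν p, E, hν.1 p, hE, hνE, hgrad, fun i j => ?_⟩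
  -- differentiate `⟪∇u, E j⟫ = |∇u| ⟪ν, E j⟫` along a curve with velocity `E i`
  set A : ℝ → EuclideanSpace ℝ (Fin (n + 1)) := fun s => φ t (chartLine p (w i) s) with hA
  set N : ℝ → EuclideanSpace ℝ (Fin (n + 1)) := fun s => ν (chartLine p (w i) s) with hN
  have hA' : HasDerivAt A (E i) 0 := hdφ i
  have hN' : HasDerivAt N (κ p i • E i) 0 := hdν i
  have hA0 : A 0 = φ t p := by simp [hA, chartLine_zero]
  have hN0 : N 0 = ν p := by simp [hN, chartLine_zero]
  have hd2 : DifferentiableAt ℝ (fderiv ℝ u) (φ t p) :=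
    (hu.fderiv_right (m := 1) (by norm_num)).differentiableAt (by simp)
  have hDA : HasDerivAt (fun s => fderiv ℝ u (A s)) (fderiv ℝ (fderiv ℝ u) (φ t p) (E i)) 0 :=
    HasFDerivAt.comp_hasDerivAt_of_eq (0 : ℝ) hd2.hasFDerivAt hA' hA0.symm
  have hDE : HasDerivAt (fun s => fderiv ℝ u (A s) (E j))
      (fderiv ℝ (fderiv ℝ u) (φ t p) (E i) (E j)) 0 :=
    (ContinuousLinearMap.apply ℝ ℝ (E j)).hasFDerivAt.comp_hasDerivAt (0 : ℝ) hDA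
  have hDN : DifferentiableAt ℝ (fun s => fderiv ℝ u (A s) (N s)) 0 :=
    hDA.differentiableAt.clm_apply hN'.differentiableAt
  have hNE : HasDerivAt (fun s => inner ℝ (N s) (E j)) (inner ℝ (κ p i • E i) (E j)) 0 := by
    simpa using hN'.inner ℝ (hasDerivAt_const (0 : ℝ) (E j))
  have hprod := hDN.hasDerivAt.mul hNE
  have heq : (fun s => fderiv ℝ u (A s) (E j)) =ᶠ[𝓝 0]
      fun s => fderiv ℝ u (A s) (N s) * inner ℝ (N s) (E j) := by
    have hc1 : Tendsto (chartLine p (w i)) (𝓝 0) (𝓝 p) := by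
      simpa [ContinuousAt, chartLine_zero] using continuousAt_chartLine p (w i)
    have hc2 : Tendsto (fun s : ℝ => (t, chartLine p (w i) s)) (𝓝 0) (𝓝 (t, p)) := by
      simpa [nhds_prod_eq] using (tendsto_const_nhds (x := t)).prodMk_nhds hc1
    have hc3 : Tendsto A (𝓝 0) (𝓝 (φ t p)) := hA0 ▸ hA'.continuousAt.tendsto
    filter_upwards [hc2.eventually hut.eventually_nhds,
      hc3.eventually (hu.eventually (by simp))] with s hs1 hs2
    have hg := hφ.fderiv_eq hF ht hν (hκp _) (hκΓ _) (hκev _)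
      (hs2.differentiableAt (by simp)) hs1
    simp only [hA, hN]
    rw [hg, hg, real_inner_self_eq_norm_sq, hν.1]
    ring
  have := hDE.unique (hprod.congr_of_eventuallyEq heq)
  rw [this, hN0, hA0, hgrad (ν p), real_inner_self_eq_norm_sq, hν.1, hνE j,
    inner_smul_left, orthonormal_iff_ite.1 hE i j]
  split_ifs <;> simp

variable [IsManifold (𝓡 n) ∞ M]

/-- The flow map is a local diffeomorphism of space-time: its velocity is transversal to the
hypersurfaces. -/
lemma exists_box (hF : IsAdmissibleSpeed Γ F) (hφ : IsExpandingFlow Γ F T₀ T₁ φ)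
    (ht : t ∈ timeInterval T₀ T₁) (p : M) :
    ∃ e : OpenPartialHomeomorph (ℝ × M) (EuclideanSpace ℝ (Fin (n + 1))),
      (t, p) ∈ e.source ∧ (∀ q ∈ e.source, q.1 ∈ timeInterval T₀ T₁ ∧ e q = φ q.1 q.2) ∧
      ContDiffAt ℝ ∞ (fun x => (e.symm x).1) (φ t p) := by
  obtain ⟨ν, hν, hev⟩ := hφ.evolution t ht
  obtain ⟨κ, hκp, hκ, hd⟩ := hev p
  obtain ⟨E, w, hE, hνE, hdφ, -⟩ := hκp.exists_frame (hφ.mdifferentiableAt ht p) hν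
  set ψ := chartAt (EuclideanSpace ℝ (Fin n)) p with hψ
  set g : ℝ × EuclideanSpace ℝ (Fin n) → EuclideanSpace ℝ (Fin (n + 1)) :=
    fun z => φ z.1 (ψ.symm z.2) with hg
  have hψp : ψ.symm (ψ p) = p := ψ.left_inv (mem_chart_source _ p)
  have hgs : ContDiffAt ℝ ∞ g (t, ψ p) := by
    have h1 : ContMDiffAt (𝓡 n) (𝓡 n) ∞ ψ.symm (ψ p) :=
      (contMDiffOn_chart_symm (I := 𝓡 n) (n := ∞) (x := p)).contMDiffAt
        (ψ.open_target.mem_nhds (mem_chart_target _ p))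
    have h2 : ContMDiffAt 𝓘(ℝ, ℝ × EuclideanSpace ℝ (Fin n)) (𝓘(ℝ, ℝ).prod (𝓡 n)) ∞
        (fun z : ℝ × EuclideanSpace ℝ (Fin n) => (z.1, ψ.symm z.2)) (t, ψ p) :=
      (contDiff_fst.contMDiff.contMDiffAt).prodMk
        (ContMDiffAt.comp (I' := 𝓡 n) (t, ψ p) h1 contDiff_snd.contMDiff.contMDiffAt)
    have h3 : ContMDiffAt (𝓘(ℝ, ℝ).prod (𝓡 n)) (𝓡 (n + 1)) ∞ (fun q : ℝ × M => φ q.1 q.2)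
        (t, ψ.symm (ψ p)) := by rw [hψp]; exact hφ.contMDiffAt ht p
    exact contMDiffAt_iff_contDiffAt.1 (ContMDiffAt.comp (t, ψ p) h3 h2)
  have hgd := (hgs.differentiableAt (by simp)).hasFDerivAt
  set g' := fderiv ℝ g (t, ψ p) with hg'
  have hν' : g' (F κ • ((1 : ℝ), (0 : EuclideanSpace ℝ (Fin n)))) = ν p := by
    have h1 : HasDerivAt (fun s : ℝ => (s, ψ p)) ((1 : ℝ), (0 : EuclideanSpace ℝ (Fin n))) t :=
      (hasDerivAt_id t).prodMk (hasDerivAt_const t _)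
    have h2 := hgd.comp_hasDerivAt t h1
    have h3 : (g ∘ fun s : ℝ => (s, ψ p)) = fun s => φ s p := by
      ext1 s; simp [hg, hψp]
    rw [h3] at h2
    rw [map_smul, h2.unique hd, smul_inv_smul₀ (hF.pos κ hκ).ne']
  have hw' : ∀ i, g' ((0 : ℝ), w i) = E i := fun i => by
    have h1 : HasDerivAt (fun s : ℝ => (t, ψ p + s • w i)) ((0 : ℝ), w i) 0 := by
      refine (hasDerivAt_const (0 : ℝ) t).prodMk ?_
      simpa using ((hasDerivAt_id (0 : ℝ)).smul_const (w i)).const_add (ψ p)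
    have h2 := HasFDerivAt.comp_hasDerivAt_of_eq (0 : ℝ) hgd h1 (by simp)
    exact h2.unique (hdφ i)
  have hsurj : Function.Surjective g' := fun v => by
    have hv := eq_inner_smul_add_sum (by simp) (hν.1 p) hE hνE v
    refine ⟨inner ℝ (ν p) v • (F κ • ((1 : ℝ), (0 : EuclideanSpace ℝ (Fin n)))) +
      ∑ i, inner ℝ (E i) v • ((0 : ℝ), w i), ?_⟩
    rw [map_add, map_smul, hν', map_sum]
    simp only [map_smul, hw']
    exact hv.symm
  have hinj : Function.Injective g' :=
    (LinearMap.injective_iff_surjective_of_finrank_eq_finrank (f := g'.toLinearMap)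
      (by simp [add_comm])).2 hsurj
  let G' : (ℝ × EuclideanSpace ℝ (Fin n)) ≃L[ℝ] EuclideanSpace ℝ (Fin (n + 1)) :=
    ContinuousLinearEquiv.ofBijective g' (LinearMap.ker_eq_bot.2 hinj)
      (LinearMap.range_eq_top.2 hsurj)
  have hG' : HasFDerivAt g (G' : (ℝ × EuclideanSpace ℝ (Fin n)) →L[ℝ] _) (t, ψ p) := by
    rw [ContinuousLinearEquiv.coe_ofBijective]; exact hgd
  have hne : (∞ : WithTop ℕ∞) ≠ 0 := by simp
  let k := hgs.toOpenPartialHomeomorph g hG' hne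
  let e₀ := ((OpenPartialHomeomorph.refl ℝ).prod ψ).trans k
  have hmem : (t, p) ∈ e₀.source := by
    rw [OpenPartialHomeomorph.trans_source]
    exact ⟨⟨trivial, mem_chart_source _ p⟩, hgs.mem_toOpenPartialHomeomorph_source hG' hne⟩
  refine ⟨e₀.restrOpen _ ((isOpen_timeInterval T₀ T₁).prod (isOpen_univ (X := M))),
    ?_, ?_, ?_⟩
  · exact ⟨hmem, ht, trivial⟩
  · rintro q ⟨hq, hqI, -⟩
    refine ⟨hqI, ?_⟩
    have hq2 : q.2 ∈ ψ.source := by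
      rw [OpenPartialHomeomorph.trans_source] at hq
      exact hq.1.2
    change φ q.1 (ψ.symm (ψ q.2)) = φ q.1 q.2
    rw [ψ.left_inv hq2]
  · have h1 := hgs.to_localInverse hG' hne
    have h2 : g (t, ψ p) = φ t p := by simp [hg, hψp]
    rw [h2] at h1
    change ContDiffAt ℝ ∞ (fun x => (hgs.localInverse hG' hne x).1) (φ t p)
    exact h1.fst

/-- An expanding flow foliates space-time, and its arrival time solves the level set equation. -/
theorem exists_foliation (hF : IsAdmissibleSpeed Γ F) (hφ : IsExpandingFlow Γ F T₀ T₁ φ)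
    [CompactSpace M] [Nonempty M] :
    ∃ (ν : ℝ → M → EuclideanSpace ℝ (Fin (n + 1)))
      (Ω : ℝ → Set (EuclideanSpace ℝ (Fin (n + 1)))),
      IsExpandingFoliation (timeInterval T₀ T₁) φ ν Ω ∧
      ∀ t ∈ timeInterval T₀ T₁, ∀ p,
        IsLevelSetSolutionAt Γ F (arrivalTime (timeInterval T₀ T₁) φ) (φ t p) := by
  have : LocallyConnectedSpace M :=
    ChartedSpace.locallyConnectedSpace (EuclideanSpace ℝ (Fin n)) M
  choose! ν hν hev using hφ.evolution
  choose! Ω hΩ hside using fun t ht => (hν t ht).2.2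
  have hfol : IsExpandingFoliation (timeInterval T₀ T₁) φ ν Ω := by
    refine ⟨ordConnected_timeInterval T₀ T₁, hΩ,
      fun t ht => (hφ.embedded t ht).isEmbedding.injective, hside, fun t ht p => ?_⟩
    obtain ⟨e, hmem, he, hsm⟩ := hφ.exists_box hF ht p
    refine ⟨e, hmem, he, hsm, ?_⟩
    obtain ⟨κ, hκp, hκ, hd⟩ := hev t ht p
    rw [hφ.fderiv_eq hF ht (hν t ht) hκp hκ hd (hsm.differentiableAt (by simp)),
      real_inner_self_eq_norm_sq, (hν t ht).1]
    · simpa using hF.pos κ hκ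
    · filter_upwards [e.open_source.mem_nhds hmem] with q hq
      rw [← (he q hq).2, e.left_inv hq]
  refine ⟨ν, Ω, hfol, fun t ht p => hφ.isLevelSetSolutionAt hF ht
    (contDiffAt_infty.1 (hfol.contDiffAt_arrivalTime ht p) 2) ?_⟩
  filter_upwards [((isOpen_timeInterval T₀ T₁).prod isOpen_univ).mem_nhds ⟨ht, mem_univ p⟩]
    with q hq
  exact hfol.arrivalTime_apply hq.1 q.2

end IsExpandingFlow

/-! ### Reflection in hyperplanes and rotational symmetry -/

section Reflection

variable {V : Type*} [NormedAddCommGroup V] [InnerProductSpace ℝ V]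

lemma exists_affine_reflection {w : V} (hw : ‖w‖ = 1) (y : V) (s : ℝ) :
    ∃ R : V ≃ᵃⁱ[ℝ] V, ∀ x, R x = x - (2 * (inner ℝ w (x - y) - s)) • w := by
  set L : V ≃ₗᵢ[ℝ] V := (ℝ ∙ w)ᗮ.reflection with hL
  have hLv : ∀ v, L v = v - (2 * inner ℝ w v) • w := fun v => by
    rw [hL, Submodule.reflection_orthogonal_apply, Submodule.reflection_singleton_apply, hw]
    simp [two_smul, two_mul, add_smul]
  refine ⟨L.toAffineIsometryEquiv.trans
    (AffineIsometryEquiv.constVAdd ℝ V ((2 * (inner ℝ w y + s)) • w)), fun x => ?_⟩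
  simp only [AffineIsometryEquiv.coe_trans, Function.comp_apply, AffineIsometryEquiv.coe_constVAdd,
    LinearIsometryEquiv.coe_toAffineIsometryEquiv, vadd_eq_add, hLv, inner_sub_right]
  module

end Reflection

namespace IsExpandingFoliation

variable {n : ℕ} {M : Type*} [TopologicalSpace M]
  {φ ν : ℝ → M → EuclideanSpace ℝ (Fin (n + 1))}
  {Ω : ℝ → Set (EuclideanSpace ℝ (Fin (n + 1)))} {t : ℝ}

lemma notMem_interior_closure {I : Set ℝ} (h : IsExpandingFoliation I φ ν Ω) (ht : t ∈ I)
    {x : EuclideanSpace ℝ (Fin (n + 1))} (hx : x ∈ frontier (Ω t)) :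
    x ∉ interior (closure (Ω t)) := by
  rw [(h.domain t ht).frontier_eq] at hx
  obtain ⟨p, rfl⟩ := hx
  intro hint
  have h1 : Tendsto (fun s : ℝ => φ t p + s • ν t p) (𝓝[>] 0) (𝓝 (φ t p)) := by
    have : ContinuousAt (fun s : ℝ => φ t p + s • ν t p) 0 := by fun_prop
    simpa using this.tendsto.mono_left nhdsWithin_le_nhds
  obtain ⟨s, hs1, hs2⟩ := ((h.side t ht p).and
    (h1.eventually (isOpen_interior.mem_nhds hint))).exists
  exact hs1.2 (interior_subset hs2)

lemma closure_subset_ball {I : Set ℝ} (h : IsExpandingFoliation I φ ν Ω) (ht : t ∈ I)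
    {y : EuclideanSpace ℝ (Fin (n + 1))} {r : ℝ} (hr : 0 < r)
    (hsub : range (φ t) ⊆ Metric.ball y r) : closure (Ω t) ⊆ Metric.ball y r := by
  rw [closure_eq_self_union_frontier, (h.domain t ht).frontier_eq]
  exact union_subset (dist_lt_of_frontier_subset_ball (h.domain t ht).isBounded
    ((h.domain t ht).frontier_eq ▸ hsub) hr) hsub

variable [LocallyConnectedSpace M] [CompactSpace M] [Nonempty M] {T₀ T₁ : EReal}

/-- Letting the reflecting hyperplanes tend to `y`, the domains of a flow coming out of `y` are
invariant under rotations about `y`, up to closure. -/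
lemma mem_closure_of_dist_eq (h : IsExpandingFoliation (timeInterval T₀ T₁) φ ν Ω)
    {Γ : Set (Fin n → ℝ)} {F : (Fin n → ℝ) → ℝ} (hF : IsAdmissibleSpeed Γ F)
    (hlevel : ∀ t ∈ timeInterval T₀ T₁, ∀ p,
      IsLevelSetSolutionAt Γ F (arrivalTime (timeInterval T₀ T₁) φ) (φ t p))
    {y : EuclideanSpace ℝ (Fin (n + 1))} (hy : ComesOutOfPoint T₀ T₁ φ y)
    (ht : t ∈ timeInterval T₀ T₁) {x x' : EuclideanSpace ℝ (Fin (n + 1))} (hx : x ∈ Ω t)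
    (hxx' : dist x' y = dist x y) : x' ∈ closure (Ω t) := by
  rcases eq_or_ne x x' with rfl | hne
  · exact subset_closure hx
  have hd : 0 < ‖x - x'‖ := norm_pos_iff.2 (sub_ne_zero.2 hne)
  set w := ‖x - x'‖⁻¹ • (x - x') with hw
  have hw1 : ‖w‖ = 1 := by
    rw [hw, norm_smul, norm_inv, norm_norm, inv_mul_cancel₀ hd.ne']
  have hinner : inner ℝ w (x - y) = ‖x - x'‖ / 2 := by
    have h1 : x' - y = (x - y) - (x - x') := by abel
    have h2 := norm_sub_sq_real (x - y) (x - x')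
    rw [dist_eq_norm, dist_eq_norm] at hxx'
    rw [← h1, hxx', real_inner_comm] at h2
    rw [hw, inner_smul_left, RCLike.conj_to_real, inv_mul_eq_iff_eq_mul₀ hd.ne']
    linarith
  have hmem : ∀ s ∈ Ioc 0 (‖x - x'‖ / 2),
      x - (2 * (inner ℝ w (x - y) - s)) • w ∈ Ω t := fun s hs => by
    obtain ⟨t₀, ht₀, hsub⟩ := hy s hs.1
    have hcl := h.closure_subset_ball ht₀ hs.1 hsub
    have hdist : ∀ z : EuclideanSpace ℝ (Fin (n + 1)), s ≤ inner ℝ w (z - y) →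
        z ∉ closure (Ω t₀) := fun z hz hmem => by
      have h1 := hcl hmem
      rw [Metric.mem_ball, dist_eq_norm] at h1
      have h2 := real_inner_le_norm w (z - y)
      rw [hw1, one_mul] at h2
      linarith
    have hxs : s ≤ inner ℝ w (x - y) := hinner ▸ hs.2
    have ht₀t : t₀ ≤ t := le_of_not_gt fun hlt =>
      hdist x hxs (subset_closure (h.domain_mono ht ht₀ hlt.le hx))
    obtain ⟨R, hR⟩ := exists_affine_reflection hw1 y s
    rw [← hR]
    have hcont : Continuous fun z : EuclideanSpace ℝ (Fin (n + 1)) => inner ℝ w (z - y) := by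
      fun_prop
    refine h.map_mem_of_disjoint hF hlevel R (H := {z | s ≤ inner ℝ w (z - y)})
      (isClosed_le continuous_const hcont) (fun z hz hzi => ?_) ht₀ hdist ht ht₀t hxs hx
    have hzs : inner ℝ w (z - y) ≤ s := le_of_not_gt fun hlt => hzi
      (interior_maximal (fun z' (hz' : s < inner ℝ w (z' - y)) => le_of_lt hz')
        (isOpen_lt continuous_const hcont) hlt)
    rw [hR, le_antisymm hzs hz]
    simp
  have hlim : Tendsto (fun s : ℝ => x - (2 * (inner ℝ w (x - y) - s)) • w) (𝓝[>] 0) (𝓝 x') := by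
    have h1 : ContinuousAt (fun s : ℝ => x - (2 * (inner ℝ w (x - y) - s)) • w) 0 := by fun_prop
    have h2 : x - (2 * (inner ℝ w (x - y) - 0)) • w = x' := by
      rw [hinner, sub_zero, mul_div_cancel₀ _ (two_ne_zero' ℝ), hw, smul_inv_smul₀ hd.ne']
      abel
    rw [← h2]
    exact h1.tendsto.mono_left nhdsWithin_le_nhds
  refine mem_closure_of_tendsto hlim ?_
  filter_upwards [Ioc_mem_nhdsGT (half_pos hd)] with s hs using hmem s hs

theorem isExpandingSpheres (h : IsExpandingFoliation (timeInterval T₀ T₁) φ ν Ω)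
    {Γ : Set (Fin n → ℝ)} {F : (Fin n → ℝ) → ℝ} (hF : IsAdmissibleSpeed Γ F)
    (hlevel : ∀ t ∈ timeInterval T₀ T₁, ∀ p,
      IsLevelSetSolutionAt Γ F (arrivalTime (timeInterval T₀ T₁) φ) (φ t p))
    {y : EuclideanSpace ℝ (Fin (n + 1))} (hy : ComesOutOfPoint T₀ T₁ φ y) :
    IsExpandingSpheres T₀ T₁ φ y := by
  have hsphere : ∀ t ∈ timeInterval T₀ T₁, ∃ ρ : ℝ, 0 < ρ ∧
      range (φ t) = Metric.sphere y ρ := fun t ht => by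
    have hD := h.domain t ht
    rw [← hD.frontier_eq]
    refine exists_frontier_eq_sphere hD.isOpen hD.isConnected hD.isBounded ?_
      (fun x hx x' hxx' => h.mem_closure_of_dist_eq hF hlevel hy ht hx hxx')
      (fun x hx => h.notMem_interior_closure ht hx)
    rw [Metric.mem_closure_iff]
    intro r hr
    obtain ⟨t₀, ht₀, hsub⟩ := hy r hr
    have hball := subset_closure.trans (h.closure_subset_ball ht₀ hr hsub)
    have ht' : min t₀ t ∈ timeInterval T₀ T₁ := by
      rcases min_choice t₀ t with h1 | h1 <;> rw [h1] <;> assumption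
    obtain ⟨x, hx⟩ := (h.domain _ ht').isConnected.nonempty
    refine ⟨x, h.domain_mono ht' ht (min_le_right _ _) hx, ?_⟩
    rw [dist_comm]
    exact hball (h.domain_mono ht' ht₀ (min_le_left _ _) hx)
  choose! ρ hρ0 hρ using hsphere
  refine ⟨ρ, fun s hs t ht hst => ?_, fun t ht => ⟨hρ0 t ht, hρ t ht⟩⟩
  obtain ⟨p⟩ := ‹Nonempty M›
  have hp : dist (φ s p) y = ρ s := (hρ s hs ▸ mem_range_self p : φ s p ∈ Metric.sphere y (ρ s))
  have hpt : φ s p ∈ Ω t := (h.mem_domain_iff hs ht p).2 hst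
  refine lt_of_le_of_ne (le_of_not_gt fun hlt => ?_) fun heq => ?_
  · have hsub : range (φ t) ⊆ Metric.ball y (ρ s) :=
      hρ t ht ▸ Metric.sphere_subset_ball hlt
    exact (h.closure_subset_ball ht (hρ0 s hs) hsub (subset_closure hpt)).ne hp
  · have : φ s p ∈ range (φ t) := by
      rw [hρ t ht, ← heq]; exact hp
    obtain ⟨q, hq⟩ := this
    exact hst.ne' (h.time_eq ht hs hq)

end IsExpandingFoliation

lemma IsHomotheticallyExpanding.comesOutOfPoint {n : ℕ} {M : Type*} [TopologicalSpace M]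
    [CompactSpace M] {T₀ T₁ : EReal} {φ : ℝ → M → EuclideanSpace ℝ (Fin (n + 1))}
    {y : EuclideanSpace ℝ (Fin (n + 1))} {S : Set (EuclideanSpace ℝ (Fin (n + 1)))}
    (hS : IsHomotheticallyExpanding T₀ T₁ φ y S)
    (hφ : ∀ t ∈ timeInterval T₀ T₁, Continuous (φ t)) : ComesOutOfPoint T₀ T₁ φ y := by
  obtain ⟨c, -, hc0, hcinf, hc⟩ := hS
  obtain ⟨t₁, ht₁, -⟩ := hcinf 1 one_pos
  have hdist : ∀ (a : ℝ) (x : EuclideanSpace ℝ (Fin (n + 1))), 0 < a →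
      dist (AffineMap.homothety y a x) y = a * dist x y := fun a x ha => by
    rw [dist_homothety_center, Real.norm_of_nonneg ha.le, dist_comm]
  obtain ⟨C, hC⟩ := (isCompact_range (hφ t₁ ht₁)).isBounded.subset_ball y
  have hSC : ∀ x ∈ S, dist x y < C / c t₁ := fun x hx => by
    have h1 := hC (hc t₁ ht₁ ▸ mem_image_of_mem _ hx)
    rw [Metric.mem_ball, hdist _ _ (hc0 t₁ ht₁)] at h1
    rw [lt_div_iff₀ (hc0 t₁ ht₁)]
    linarith
  intro r hr
  obtain ⟨t, ht, hct⟩ := hcinf (r / (|C / c t₁| + 1)) (by positivity)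
  refine ⟨t, ht, ?_⟩
  rw [hc t ht]
  rintro _ ⟨x, hx, rfl⟩
  rw [Metric.mem_ball, hdist _ _ (hc0 t ht)]
  rw [lt_div_iff₀ (by positivity)] at hct
  have h1 := (hSC x hx).trans_le (le_abs_self _)
  have h2 := hc0 t ht
  nlinarith

theorem theorem1 {n : ℕ} (hn : 1 ≤ n)
    (Γ : Set (Fin n → ℝ)) (F : (Fin n → ℝ) → ℝ) (hF : IsAdmissibleSpeed Γ F)
    {M : Type*} [TopologicalSpace M] [ChartedSpace (EuclideanSpace ℝ (Fin n)) M]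
    [IsManifold (𝓡 n) ∞ M] [T2Space M] [CompactSpace M]
    (T₀ T₁ : EReal) (hT : T₀ < T₁)
    (φ : ℝ → M → EuclideanSpace ℝ (Fin (n + 1)))
    (hφ : IsExpandingFlow Γ F T₀ T₁ φ) :
    (∀ y : EuclideanSpace ℝ (Fin (n + 1)),
      ComesOutOfPoint T₀ T₁ φ y → IsExpandingSpheres T₀ T₁ φ y) ∧
    (∀ (y : EuclideanSpace ℝ (Fin (n + 1))) (S : Set (EuclideanSpace ℝ (Fin (n + 1)))),
      IsHomotheticallyExpanding T₀ T₁ φ y S →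
        IsExpandingSpheres T₀ T₁ φ y ∧ ∃ r : ℝ, 0 < r ∧ S = Metric.sphere y r) := by
  obtain ⟨t₁, ht₁⟩ : ∃ t₁, t₁ ∈ timeInterval T₀ T₁ := EReal.lt_iff_exists_real_btwn.1 hT
  -- a bounded domain cannot have empty boundary
  have : Nonempty M := by
    by_contra hM
    rw [not_nonempty_iff] at hM
    obtain ⟨ν, ⟨-, -, Ω, hΩ, -⟩, -⟩ := hφ.evolution t₁ ht₁
    have h1 := hΩ.frontier_eq
    rw [range_eq_empty, frontier_eq_empty_iff] at h1
    rcases h1 with h1 | h1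
    · exact hΩ.isConnected.nonempty.ne_empty h1
    · have := hΩ.isBounded
      rw [h1] at this
      exact NormedSpace.unbounded_univ ℝ _ this
  have : LocallyConnectedSpace M :=
    ChartedSpace.locallyConnectedSpace (EuclideanSpace ℝ (Fin n)) M
  obtain ⟨ν, Ω, hfol, hlevel⟩ := hφ.exists_foliation hF
  have hmain : ∀ y, ComesOutOfPoint T₀ T₁ φ y → IsExpandingSpheres T₀ T₁ φ y :=
    fun y hy => hfol.isExpandingSpheres hF hlevel hy
  refine ⟨hmain, fun y S hS => ?_⟩
  have hsph := hmain y (hS.comesOutOfPoint fun t ht => (hφ.embedded t ht).isEmbedding.continuous)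
  refine ⟨hsph, ?_⟩
  obtain ⟨ρ, -, hρ⟩ := hsph
  obtain ⟨c, -, hc0, -, hc⟩ := hS
  obtain ⟨hρ0, hρ1⟩ := hρ t₁ ht₁
  have hc1 := hc0 t₁ ht₁
  refine ⟨ρ t₁ / c t₁, div_pos hρ0 hc1, ?_⟩
  rw [hc t₁ ht₁] at hρ1
  have hinj : Function.Injective (AffineMap.homothety y (c t₁) :
      EuclideanSpace ℝ (Fin (n + 1)) → EuclideanSpace ℝ (Fin (n + 1))) := fun a b hab => by
    simpa [AffineMap.homothety_apply, hc1.ne'] using hab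
  ext x
  rw [← hinj.mem_set_image, hρ1, Metric.mem_sphere, Metric.mem_sphere, dist_homothety_center,
    Real.norm_of_nonneg hc1.le, dist_comm, eq_div_iff hc1.ne', mul_comm]
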